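/- Let $\mathbb{D}$ be the open unit disk and $\mathbb{T}$ the unit circle in $\mathbb{C}$, let $\alpha\in(0,2]$, let $k\ge 1$ be an integer, and put $$M=\frac{\Gamma(k+1+\frac{\alpha}{2})}{k^{2}\,\Gamma(k+1)\,\Gamma(2+\frac{\alpha}{2})},\qquad N=\frac{\alpha}{2\left(\frac{(k-\frac{\alpha}{2})\Gamma(k+1)\Gamma(2+\frac{\alpha}{2})}{\Gamma(k+1+\frac{\alpha}{2})}+k\right)},\qquad L=\min\{M,N\}.$$ Let $c_{-k}$ be a real number with $c_{-k}\in(-L,L)$. For $j\ge 1$ let $F_j(1)=\lim_{t\to1^-}F(-\frac{\alpha}{2},j-\frac{\alpha}{2};j+1;t)$, where $F(a,b;c;t)$ is the Gauss hypergeometric function, and define $f:\mathbb{T}\to\mathbb{C}$ by $$f(e^{i\theta})=F_1(1)e^{i\theta}+c_{-k}F_k(1)e^{-ik\theta}.$$ Then $f$ is a homeomorphism of $\mathbb{T}$ onto a convex Jordan curve $\gamma$, which is the boundary of a bounded convex domain $\Omega\subset\mathbb{C}$. Furthermore, the function $$u(z)=\frac{1}{2\pi}\int_0^{2\pi}K_\alpha(ze^{-i\tau})f(e^{i\tau})\,d\tau,\quad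 z\in\mathbb{D},\qquad K_\alpha(z)=\frac{\Gamma(\frac{\alpha}{2}+1)^2}{\Gamma(1+\alpha)}\,\frac{(1-|z|^2)^{\alpha+1}}{|1-z|^{\alpha+2}},$$ is a univalent (injective) real kernel $\alpha$-harmonic mapping of $\mathbb{D}$ onto $\Omega$. Here a real kernel $\alpha$-harmonic mapping is a function $u\in C^2(\mathbb{D})$ satisfying in $\mathbb{D}$ the equation $$-\frac{\alpha^2}{4}(1-|z|^2)^{-\alpha-1}u+\frac{\alpha}{2}(1-|z|^2)^{-\alpha-1}\left(z\frac{\partial u}{\partial z}+\bar z\frac{\partial u}{\partial\bar z}\right)+(1-|z|^2)^{-\alpha}\frac{\partial^2u}{\partial z\,\partial\bar z}=0 .$$ -/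

import Mathlib

open Filter Topology Set

noncomputable section

namespace RealKernel

/-- The Wirtinger derivative `∂u/∂z = (u_x - i u_y) / 2`. -/
def dz (u : ℂ → ℂ) (z : ℂ) : ℂ :=
  (fderiv ℝ u z 1 - Complex.I * fderiv ℝ u z Complex.I) / 2

/-- The Wirtinger derivative `∂u/∂z̄ = (u_x + i u_y) / 2`. -/
def dzbar (u : ℂ → ℂ) (z : ℂ) : ℂ :=
  (fderiv ℝ u z 1 + Complex.I * fderiv ℝ u z Complex.I) / 2

/-- The differential operator
`T_α = -(α²/4)(1-|z|²)^(-α-1) + (α/2)(1-|z|²)^(-α-1) (z ∂_z + z̄ ∂_z̄) + (1-|z|²)^(-α) ∂_z ∂_z̄`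
(used at points of the open unit disk).  The second order part is normalized as `∂_z ∂_z̄`, one
quarter of `∂²/∂x² + ∂²/∂y²`; this is the normalization for which the kernel `kernelK α` and the
functions `F(-α/2, k-α/2; k+1; |z|²) z^k` are annihilated. -/
def opT (α : ℝ) (u : ℂ → ℂ) (z : ℂ) : ℂ :=
  -((α ^ 2 / 4 * (1 - ‖z‖ ^ 2) ^ (-α - 1) : ℝ) : ℂ) * u z
    + ((α / 2 * (1 - ‖z‖ ^ 2) ^ (-α - 1) : ℝ) : ℂ)
        * (z * dz u z + (starRingEnd ℂ) z * dzbar u z)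
    + (((1 - ‖z‖ ^ 2) ^ (-α) : ℝ) : ℂ) * dz (dzbar u) z

/-- Real kernel `α`-harmonic mappings of the open unit disk: `C²` solutions of `T_α u = 0`. -/
def IsRealKernelHarmonic (α : ℝ) (u : ℂ → ℂ) : Prop :=
  ContDiffOn ℝ 2 u (Metric.ball 0 1) ∧ ∀ z ∈ Metric.ball (0 : ℂ) 1, opT α u z = 0

/-- The kernel `K_α(z) = c_α (1-|z|²)^(α+1) / |1-z|^(α+2)`, `c_α = Γ(α/2+1)² / Γ(1+α)`. -/
def kernelK (α : ℝ) (z : ℂ) : ℝ :=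
  Real.Gamma (α / 2 + 1) ^ 2 / Real.Gamma (1 + α)
    * ((1 - ‖z‖ ^ 2) ^ (α + 1) / ‖1 - z‖ ^ (α + 2))

/-- The Poisson type integral
`u(z) = (1/2π) ∫_0^{2π} K_α(z e^{-iτ}) g(e^{iτ}) dτ` of a function `g` on the unit circle. -/
def poissonExt (α : ℝ) (g : Circle → ℂ) (z : ℂ) : ℂ :=
  (1 / (2 * Real.pi) : ℂ) * ∫ τ in (0 : ℝ)..(2 * Real.pi),
    (kernelK α (z * Complex.exp (-(τ * Complex.I))) : ℂ) * g (Circle.exp τ)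

/-- `F_k(t) = F(-α/2, k-α/2; k+1; t)`, with the Gauss hypergeometric function. -/
def hypF (α : ℝ) (k : ℕ) (t : ℝ) : ℝ :=
  ordinaryHypergeometric (-α / 2) ((k : ℝ) - α / 2) ((k : ℝ) + 1) t

/-- `F_k(1) = lim_{t → 1⁻} F_k(t)`. -/
def hypFOne (α : ℝ) (k : ℕ) : ℝ :=
  limUnder (𝓝[<] (1 : ℝ)) (hypF α k)

/-- The boundary map `f(e^{iθ}) = F_1(1) e^{iθ} + c F_k(1) e^{-ikθ}`. -/
def boundaryMap (α : ℝ) (k : ℕ) (c : ℝ) (ζ : Circle) : ℂ :=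
  (hypFOne α 1 : ℂ) * (ζ : ℂ) + (c : ℂ) * (hypFOne α k : ℂ) * (ζ : ℂ) ^ (-(k : ℤ))

/-- `M = Γ(k+1+α/2) / (k² Γ(k+1) Γ(2+α/2))`. -/
def boundM (α : ℝ) (k : ℕ) : ℝ :=
  Real.Gamma ((k : ℝ) + 1 + α / 2)
    / ((k : ℝ) ^ 2 * Real.Gamma ((k : ℝ) + 1) * Real.Gamma (2 + α / 2))

/-- `N = α / (2 ((k-α/2) Γ(k+1) Γ(2+α/2) / Γ(k+1+α/2) + k))`. -/
def boundN (α : ℝ) (k : ℕ) : ℝ :=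
  α / (2 * (((k : ℝ) - α / 2) * Real.Gamma ((k : ℝ) + 1) * Real.Gamma (2 + α / 2)
    / Real.Gamma ((k : ℝ) + 1 + α / 2) + (k : ℝ)))

end RealKernel

end

/-! Write `a = α/2` and `F_j(t) = F(-a, j-a; j+1; t)`. On the unit circle the weight `|1-w|^(-α-2)`
is the squared modulus of `(1-w)^(-(a+1))`, so binomial series give its Fourier coefficients:
against `e^{ijτ}` the kernel integrates to a multiple of `(1-t)^(1+2a) F(a+1, a+1+j; j+1; t) z^j`
with `t = |z|²`. Euler's transformation (`radial_euler`) turns this into `F_j(t) z^j`, and Gauss's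
summation (`tendsto_psum_radCoeff`) identifies the constant as `1 / F_j(1)`. Hence `u(z) = F_1(|z|²)
z + c F_k(|z|²) z̄^k`, the map `closedForm`, and the equation `T_α u = 0` is the hypergeometric
equation for `F_1` and `F_k`.

Univalence comes from a monotonicity estimate. Since `F_j' ≤ 0`, `F_k ≤ F_1` and `F_1 + 2tF_1' ≥ a
F_1` (`radial_logDeriv_bound`), one gets `Re u_z - |u_z̄| ≥ δ` with `δ = (a - |c|k) F_1(1)`,
positive because `|c| < N`. Integrating along segments gives `|u(z) - u(w)| ≥ δ|z - w|`, which
survives on the closed disk for the continuous extension of `u`, whose boundary values are `f`. So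
`f` is an embedding, and the image of the disk is a bounded open set with frontier `f(𝕋)`.

Convexity uses `|c| < M`, that is `k²|c| F_k(1) < F_1(1)`: the curve then lies on one side of each
of its tangent lines (`support_line`), and an open set with a strict support functional at each
frontier point is convex. -/

noncomputable section

namespace RealKernel

/-! ### Real power series converging on the unit interval -/

/-- Coefficient sequences whose power series converges absolutely on the open unit disk. -/
def DiskSummable (c : ℕ → ℝ) : Prop :=
  ∀ r : ℝ, 0 ≤ r → r < 1 → Summable fun n => |c n| * r ^ n

/-- The sum of the power series with coefficients `c`. -/
def psum (c : ℕ → ℝ) (t : ℝ) : ℝ := ∑' n, c n * t ^ n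

/-- The coefficients of the formal derivative. -/
def dcoeff (c : ℕ → ℝ) (n : ℕ) : ℝ := (n + 1) * c (n + 1)

lemma DiskSummable.summable {c : ℕ → ℝ} (hc : DiskSummable c) {t : ℝ} (ht : |t| < 1) :
    Summable fun n => c n * t ^ n := by
  refine Summable.of_norm ?_
  simpa [abs_mul, abs_pow] using hc |t| (abs_nonneg t) ht

lemma DiskSummable.hasSum {c : ℕ → ℝ} (hc : DiskSummable c) {t : ℝ} (ht : |t| < 1) :
    HasSum (fun n => c n * t ^ n) (psum c t) :=
  (hc.summable ht).hasSum

lemma DiskSummable.hasFPowerSeries {c : ℕ → ℝ} (hc : DiskSummable c) :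
    HasFPowerSeriesOnBall (psum c) (FormalMultilinearSeries.ofScalars ℝ c) 0 1 := by
  have hrad : (1 : ENNReal) ≤ (FormalMultilinearSeries.ofScalars ℝ c).radius := by
    refine ENNReal.le_of_forall_nnreal_lt fun r hr => ?_
    refine FormalMultilinearSeries.le_radius_of_summable_norm _ ?_
    have hr1 : (r : ℝ) < 1 := by exact_mod_cast hr
    refine (hc r r.2 hr1).of_nonneg_of_le (fun n => by positivity) fun n => ?_
    gcongr
    rw [FormalMultilinearSeries.ofScalars_norm]
    simp
  have h := (FormalMultilinearSeries.ofScalars ℝ c).hasFPowerSeriesOnBall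
    (lt_of_lt_of_le one_pos hrad)
  have h' := h.mono one_pos hrad
  refine h'.congr fun t _ => ?_
  simp [psum, FormalMultilinearSeries.sum, mul_comm]

lemma DiskSummable.analyticAt {c : ℕ → ℝ} (hc : DiskSummable c) {t : ℝ} (ht : |t| < 1) :
    AnalyticAt ℝ (psum c) t := by
  refine hc.hasFPowerSeries.analyticAt_of_mem ?_
  simpa [enorm_eq_nnnorm] using! ht

/-- For `r < s < 1` the factor `n + 1` is absorbed by the geometric decay of `(r/s)^n`. -/
lemma DiskSummable.dcoeff {c : ℕ → ℝ} (hc : DiskSummable c) : DiskSummable (dcoeff c) := by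
  intro r hr0 hr1
  obtain ⟨s, hrs, hs1⟩ := exists_between hr1
  have hs0 : 0 < s := lt_of_le_of_lt hr0 hrs
  have hq : ‖r / s‖ < 1 := by
    rw [Real.norm_of_nonneg (by positivity), div_lt_one hs0]; exact hrs
  have h1 : Tendsto (fun n : ℕ => ((n : ℝ) ^ 1 * (r / s) ^ n)) atTop (𝓝 0) :=
    (summable_pow_mul_geometric_of_norm_lt_one 1 hq).tendsto_atTop_zero
  have h2 : Tendsto (fun n : ℕ => ((r / s) ^ n)) atTop (𝓝 0) :=
    tendsto_pow_atTop_nhds_zero_of_norm_lt_one hq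
  have h3 : ∀ᶠ n : ℕ in atTop, ((n : ℝ) + 1) * (r / s) ^ n ≤ 1 := by
    have h := h1.add h2
    simp only [add_zero] at h
    filter_upwards [h.eventually (eventually_le_nhds one_pos)] with n hn
    calc ((n : ℝ) + 1) * (r / s) ^ n = (n : ℝ) ^ 1 * (r / s) ^ n + (r / s) ^ n := by ring
      _ ≤ 1 := hn
  have h4 : Summable fun n => |c (n + 1)| * s ^ n := by
    have h := ((summable_nat_add_iff 1).2 (hc s hs0.le hs1)).mul_right s⁻¹
    refine h.congr fun n => ?_
    rw [pow_succ]; field_simp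
  refine Summable.of_norm_bounded_eventually_nat h4 ?_
  filter_upwards [h3] with n hn
  rw [Real.norm_of_nonneg (by positivity), RealKernel.dcoeff, abs_mul,
    abs_of_nonneg (by positivity : (0 : ℝ) ≤ n + 1)]
  calc ((n : ℝ) + 1) * |c (n + 1)| * r ^ n
      = (((n : ℝ) + 1) * (r / s) ^ n) * (|c (n + 1)| * s ^ n) := by
        rw [div_pow]; field_simp
    _ ≤ 1 * (|c (n + 1)| * s ^ n) := by gcongr
    _ = |c (n + 1)| * s ^ n := one_mul _

lemma hasSum_shift {d e : ℕ → ℝ} {t S : ℝ} (h : HasSum (fun n => d n * t ^ n) S)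
    (h0 : e 0 = 0) (hs : ∀ n, e (n + 1) = d n) : HasSum (fun n => e n * t ^ n) (t * S) := by
  rw [← hasSum_nat_add_iff' 1]
  simp only [Finset.range_one, Finset.sum_singleton, h0, zero_mul, sub_zero, hs]
  refine (h.mul_left t).congr_fun ?_
  intro n
  ring

lemma DiskSummable.hasDerivAt {c : ℕ → ℝ} (hc : DiskSummable c) {t : ℝ} (ht : |t| < 1) :
    HasDerivAt (psum c) (psum (RealKernel.dcoeff c) t) t := by
  obtain ⟨r, htr, hr1⟩ := exists_between ht
  have hr0 : 0 ≤ r := (abs_nonneg t).trans htr.le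
  have hsum := hc.dcoeff r hr0 hr1
  have hu : Summable fun n : ℕ => |(n : ℝ) * c n| * r ^ (n - 1) := by
    rw [← summable_nat_add_iff 1]
    refine hsum.congr fun n => ?_
    simp [RealKernel.dcoeff]
  have hder := hasDerivAt_tsum_of_isPreconnected (g := fun (n : ℕ) (y : ℝ) => c n * y ^ n)
    (g' := fun (n : ℕ) (y : ℝ) => c n * (n * y ^ (n - 1))) hu isOpen_Ioo isPreconnected_Ioo
    (t := Ioo (-r) r) (fun n y _ => (hasDerivAt_pow n y).const_mul (c n)) ?_
    (abs_lt.1 htr) (hc.summable ht) (abs_lt.1 htr)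
  · convert! hder using 1
    have h2 : Summable fun n : ℕ => c n * (n * t ^ (n - 1)) := by
      rw [← summable_nat_add_iff 1]
      refine (hc.dcoeff.summable ht).congr fun n => ?_
      simp [RealKernel.dcoeff]; ring
    rw [h2.tsum_eq_zero_add]
    simp only [Nat.cast_zero, zero_mul, mul_zero, zero_add, psum]
    refine tsum_congr fun n => ?_
    simp [RealKernel.dcoeff]; ring
  · intro n y hy
    have hy' : |y| ≤ r := abs_le.2 ⟨hy.1.le, hy.2.le⟩
    rw [Real.norm_eq_abs, ← mul_assoc, abs_mul, abs_pow, mul_comm (c n)]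
    gcongr

lemma psum_zero (c : ℕ → ℝ) : psum c 0 = c 0 := by
  rw [psum, tsum_eq_single 0]
  · simp
  · intro n hn; simp [hn]

/-! ### Hypergeometric coefficients -/

/-- The coefficients of the Gauss hypergeometric series. -/
def hyp (A B C : ℝ) : ℕ → ℝ := ordinaryHypergeometricCoefficient A B C

lemma hyp_zero (A B C : ℝ) : hyp A B C 0 = 1 := by
  simp [hyp, ordinaryHypergeometricCoefficient]

lemma hyp_succ (A B C : ℝ) (n : ℕ) :
    hyp A B C (n + 1) = hyp A B C n * ((A + n) * (B + n) / ((C + n) * (n + 1))) := by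
  simp only [hyp, ordinaryHypergeometricCoefficient, ascPochhammer_succ_eval, Nat.factorial_succ,
    Nat.cast_mul, Nat.cast_add, Nat.cast_one, mul_inv, div_eq_mul_inv]
  ring

lemma tendsto_add_div_add (A B : ℝ) :
    Tendsto (fun n : ℕ => (A + n) / (B + n)) atTop (𝓝 1) := by
  have h : ∀ᶠ n : ℕ in atTop, 1 + (A - B) / (B + n) = (A + n) / (B + n) := by
    filter_upwards [(tendsto_natCast_atTop_atTop (R := ℝ)).eventually_gt_atTop (-B)] with n hn
    have : B + n ≠ 0 := by linarith
    field_simp; ring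
  refine Tendsto.congr' h ?_
  have h1 : Tendsto (fun n : ℕ => (A - B) / (B + n)) atTop (𝓝 0) :=
    Tendsto.const_div_atTop (tendsto_atTop_add_const_left _ _ tendsto_natCast_atTop_atTop) _
  simpa using h1.const_add 1

lemma diskSummable_hyp (A B C : ℝ) : DiskSummable (hyp A B C) := by
  intro r hr0 hr1
  obtain ⟨s, hrs, hs1⟩ := exists_between hr1
  have h : Tendsto (fun n : ℕ => |(A + n) / (C + n) * ((B + n) / (1 + n))| * r) atTop
      (𝓝 (|1 * 1| * r)) :=
    (((tendsto_add_div_add A C).mul (tendsto_add_div_add B 1)).abs).mul_const r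
  rw [one_mul, abs_one, one_mul] at h
  refine summable_of_ratio_norm_eventually_le hs1 ?_
  filter_upwards [h.eventually (eventually_le_nhds hrs)] with n hn
  rw [hyp_succ, Real.norm_of_nonneg (by positivity), Real.norm_of_nonneg (by positivity), abs_mul,
    pow_succ]
  have he : (A + n) * (B + n) / ((C + n) * (n + 1)) = (A + n) / (C + n) * ((B + n) / (1 + n)) := by
    rw [div_mul_div_comm, add_comm (n : ℝ) 1]
  rw [he]
  calc _ = |(A + n) / (C + n) * ((B + n) / (1 + n))| * r * (|hyp A B C n| * r ^ n) := by ring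
    _ ≤ s * (|hyp A B C n| * r ^ n) := by gcongr

lemma ordinaryHypergeometric_eq_psum (A B C t : ℝ) :
    ordinaryHypergeometric A B C t = psum (hyp A B C) t := by
  simp [ordinaryHypergeometric_eq_tsum, psum, hyp, ordinaryHypergeometricCoefficient]

/-- The hypergeometric differential equation. -/
lemma hyp_ode {A B C : ℝ} (hC : ∀ n : ℕ, C + n ≠ 0) {t : ℝ} (ht : |t| < 1) :
    t * (1 - t) * psum (dcoeff (dcoeff (hyp A B C))) t
      + (C - (A + B + 1) * t) * psum (dcoeff (hyp A B C)) t
      - A * B * psum (hyp A B C) t = 0 := by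
  set c := hyp A B C with hcdef
  have hc : DiskSummable c := diskSummable_hyp A B C
  have h0 := hc.hasSum ht
  have h1 := hc.dcoeff.hasSum ht
  have h2 := hc.dcoeff.dcoeff.hasSum ht
  -- Coefficient sequences of `t c'`, `t c''` and `t² c''`; comparing coefficients in the equation
  -- then leaves exactly the two-term recursion `hyp_succ`.
  have t1 := hasSum_shift (e := fun n => n * c n) h1 (by simp) (by intro n; simp [dcoeff])
  have t2 := hasSum_shift (e := fun n => n * dcoeff c n) h2 (by simp)
    (by intro n; simp [dcoeff])
  have t22 := hasSum_shift (e := fun n => n * (n - 1) * c n) t2 (by simp)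
    (by intro n; simp [dcoeff]; ring)
  have key := (((t2.sub t22).add (h1.mul_left C)).sub (t1.mul_left (A + B + 1))).sub
    (h0.mul_left (A * B))
  have hz := key.unique ((hasSum_zero (α := ℝ) (β := ℕ)).congr_fun fun n => ?_)
  · linear_combination hz
  · have hn := hyp_succ A B C n
    have hne := hC n
    have hne' : (n : ℝ) + 1 ≠ 0 := by positivity
    have : c (n + 1) * ((C + n) * (n + 1)) = c n * ((A + n) * (B + n)) := by
      rw [hcdef, hn]; field_simp
    simp only [dcoeff]
    linear_combination (t ^ n) * this

/-! ### The radial factors `F_j`: signs, comparison in `j`, Euler's transformation -/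

/-- The coefficients of `F_j`, as a function of `a = α / 2`. -/
abbrev radCoeff (a : ℝ) (j : ℕ) : ℕ → ℝ := hyp (-a) (j - a) (j + 1)

lemma hypF_eq_psum (α : ℝ) (j : ℕ) : hypF α j = psum (radCoeff (α / 2) j) := by
  funext t
  rw [hypF, ordinaryHypergeometric_eq_psum, radCoeff, neg_div]

lemma natCast_add_one_add_ne_zero (j n : ℕ) : (j : ℝ) + 1 + n ≠ 0 := by positivity

section radial

variable {a : ℝ} {j : ℕ}

/-- The coefficient of index 1 is `-a(j-a)/(j+1) ≤ 0`, and all later ratios are nonnegative because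
`a ≤ 1 ≤ j`. This makes `F_j` decreasing on `[0, 1)`. -/
lemma radCoeff_nonpos (ha0 : 0 < a) (ha1 : a ≤ 1) (hj : 1 ≤ j) (n : ℕ) :
    radCoeff a j (n + 1) ≤ 0 := by
  have hj' : (1 : ℝ) ≤ j := by exact_mod_cast hj
  induction n with
  | zero =>
    rw [radCoeff, hyp_succ, hyp_zero]
    simp only [Nat.cast_zero, add_zero, zero_add, mul_one, one_mul]
    exact div_nonpos_of_nonpos_of_nonneg (by nlinarith) (by positivity)
  | succ n ih =>
    rw [radCoeff, hyp_succ]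
    refine mul_nonpos_of_nonpos_of_nonneg ih (div_nonneg (mul_nonneg ?_ ?_) (by positivity))
    · push_cast; have : (0 : ℝ) ≤ n := n.cast_nonneg
      linarith
    · push_cast; have : (0 : ℝ) ≤ n := n.cast_nonneg
      linarith

/-- The ratio `(j-a+n)/(j+1+n)` increases with `j`, while the coefficients of positive index are
nonpositive, so a larger ratio pushes them further down. -/
lemma radCoeff_anti {k : ℕ} (ha0 : 0 < a) (ha1 : a ≤ 1) (hj : 1 ≤ j) (hjk : j ≤ k) (n : ℕ) :
    radCoeff a k n ≤ radCoeff a j n := by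
  have hj' : (1 : ℝ) ≤ j := by exact_mod_cast hj
  have hjk' : (j : ℝ) ≤ k := by exact_mod_cast hjk
  have hratio : ∀ n : ℕ, (j - a + n) / ((j : ℝ) + 1 + n) ≤ (k - a + n) / ((k : ℝ) + 1 + n) := by
    intro n
    rw [div_le_div_iff₀ (by positivity) (by positivity)]
    nlinarith
  have hnn : ∀ n : ℕ, 0 ≤ (j - a + n) / ((j : ℝ) + 1 + n) := fun n =>
    div_nonneg (by have : (0 : ℝ) ≤ n := n.cast_nonneg
                   linarith) (by positivity)
  have hstep : ∀ (i n : ℕ), radCoeff a i (n + 1)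
      = radCoeff a i n * ((i - a + n) / ((i : ℝ) + 1 + n)) * ((n - a) / (n + 1)) := by
    intro i n
    rw [radCoeff, hyp_succ]
    field_simp
    ring
  induction n with
  | zero => simp [radCoeff, hyp_zero]
  | succ n ih =>
    rw [hstep k, hstep j]
    -- The common factor `(n-a)/(n+1)` is negative for `n = 0` and nonnegative afterwards; the first
    -- step starts from the coefficient 1 instead of a nonpositive one.
    rcases n with _ | n
    · simp only [radCoeff, hyp_zero, one_mul]
      refine mul_le_mul_of_nonpos_right (hratio 0) ?_
      simp [ha0.le]
    · refine mul_le_mul_of_nonneg_right ?_ (div_nonneg ?_ (by positivity))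
      · have h1 := radCoeff_nonpos ha0 ha1 hj n
        have h2 := radCoeff_nonpos ha0 ha1 (hj.trans hjk) n
        calc _ ≤ radCoeff a k (n + 1) * ((j - a + (n + 1 : ℕ)) / ((j : ℝ) + 1 + (n + 1 : ℕ))) :=
              mul_le_mul_of_nonpos_left (hratio _) h2
          _ ≤ _ := mul_le_mul_of_nonneg_right ih (hnn _)
      · push_cast; have : (0 : ℝ) ≤ n := n.cast_nonneg
        linarith

lemma abs_lt_one_of_mem {t : ℝ} (ht : t ∈ Ico (0 : ℝ) 1) : |t| < 1 := by
  rw [abs_of_nonneg ht.1]; exact ht.2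

lemma psum_radCoeff_anti {k : ℕ} (ha0 : 0 < a) (ha1 : a ≤ 1) (hj : 1 ≤ j) (hjk : j ≤ k)
    {t : ℝ} (ht : t ∈ Ico (0 : ℝ) 1) : psum (radCoeff a k) t ≤ psum (radCoeff a j) t := by
  have h1 := (diskSummable_hyp (-a) (k - a) (k + 1)).hasSum (abs_lt_one_of_mem ht)
  have h2 := (diskSummable_hyp (-a) (j - a) (j + 1)).hasSum (abs_lt_one_of_mem ht)
  refine hasSum_le (fun n => ?_) h1 h2
  exact mul_le_mul_of_nonneg_right (radCoeff_anti ha0 ha1 hj hjk n) (pow_nonneg ht.1 n)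

lemma psum_dcoeff_radCoeff_nonpos (ha0 : 0 < a) (ha1 : a ≤ 1) (hj : 1 ≤ j)
    {t : ℝ} (ht : t ∈ Ico (0 : ℝ) 1) : psum (dcoeff (radCoeff a j)) t ≤ 0 := by
  refine tsum_nonpos fun n => ?_
  refine mul_nonpos_of_nonpos_of_nonneg ?_ (pow_nonneg ht.1 n)
  exact mul_nonpos_of_nonneg_of_nonpos (by positivity) (radCoeff_nonpos ha0 ha1 hj n)

lemma radCoeff_ode (a : ℝ) (j : ℕ) {t : ℝ} (ht : |t| < 1) :
    t * (1 - t) * psum (dcoeff (dcoeff (radCoeff a j))) t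
      + (j + 1 - (j + 1 - 2 * a) * t) * psum (dcoeff (radCoeff a j)) t
      + a * (j - a) * psum (radCoeff a j) t = 0 := by
  have h := hyp_ode (A := -a) (B := j - a) (C := j + 1) (natCast_add_one_add_ne_zero j) ht
  linear_combination h

lemma hasDerivAt_one_sub_rpow (p : ℝ) {t : ℝ} (ht : t < 1) :
    HasDerivAt (fun t : ℝ => (1 - t) ^ p) (-(p * (1 - t) ^ (p - 1))) t := by
  have h := ((hasDerivAt_id t).const_sub 1).rpow_const (p := p) (Or.inl (by simp; linarith))
  convert! h using 1
  simp

/-- The logarithmic derivative of `F_j` satisfies `-2 t F_j' ≤ (j - a) F_j`. -/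
lemma radial_logDeriv_bound (ha0 : 0 < a) (ha1 : a ≤ 1) (hj : 1 ≤ j)
    {t : ℝ} (ht : t ∈ Ico (0 : ℝ) 1) :
    0 ≤ (j - a) * psum (radCoeff a j) t + 2 * t * psum (dcoeff (radCoeff a j)) t := by
  set c := radCoeff a j with hcdef
  have hc : DiskSummable c := diskSummable_hyp _ _ _
  have hj' : (1 : ℝ) ≤ j := by exact_mod_cast hj
  set φ : ℝ → ℝ := fun t => (j - a) * psum c t + 2 * t * psum (dcoeff c) t with hφ
  -- The integrating factor `(1-t)^(-2a)` makes the differential equation eliminate both `F_j''` and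
  -- `F_j`, leaving a multiple of `F_j' ≤ 0` with negative coefficient.
  have hder : ∀ x ∈ Ico (0 : ℝ) 1, HasDerivAt (fun t => (1 - t) ^ (-2 * a) * φ t)
      ((1 - x) ^ (-2 * a) * (-(j + a) * psum (dcoeff c) x)) x := by
    intro x hx
    have hx' := abs_lt_one_of_mem hx
    have h1 := ((hc.hasDerivAt hx').const_mul (j - a)).add
      (((hasDerivAt_id x).const_mul 2).mul (hc.dcoeff.hasDerivAt hx'))
    have h2 := (hasDerivAt_one_sub_rpow (-2 * a) hx.2).mul h1
    convert! h2 using 1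
    have hpos : 0 < 1 - x := by linarith [hx.2]
    have hp : (1 - x) ^ (-2 * a) = (1 - x) ^ (-2 * a - 1) * (1 - x) := by
      rw [← Real.rpow_add_one hpos.ne']; congr 1; ring
    have hode := radCoeff_ode a j hx'
    simp only [id, Pi.add_apply, Pi.mul_apply]
    rw [hp]
    linear_combination (-2 * (1 - x) ^ (-2 * a - 1)) * hode
  have hmono : MonotoneOn (fun t => (1 - t) ^ (-2 * a) * φ t) (Ico 0 1) := by
    refine monotoneOn_of_deriv_nonneg (convex_Ico 0 1)
      (fun x hx => (hder x hx).continuousAt.continuousWithinAt)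
      (fun x hx => (hder x (interior_subset hx)).differentiableAt.differentiableWithinAt)
      fun x hx => ?_
    rw [(hder x (interior_subset hx)).deriv]
    have hx := interior_subset hx
    have := psum_dcoeff_radCoeff_nonpos ha0 ha1 hj hx
    have hpos : 0 < 1 - x := by linarith [hx.2]
    exact mul_nonneg (by positivity) (by nlinarith)
  have h := hmono (left_mem_Ico.2 one_pos) ht ht.1
  have hpos : 0 < 1 - t := by linarith [ht.2]
  have h0 : 0 ≤ (1 - t) ^ (-2 * a) * φ t := by
    refine le_trans ?_ h
    simp only [hφ, psum_zero, sub_zero, Real.one_rpow, hcdef, radCoeff, hyp_zero]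
    linarith
  exact nonneg_of_mul_nonneg_right h0 (by positivity)

/-- Euler's transformation for `F_j`. -/
lemma radial_euler (ha0 : 0 < a) (j : ℕ) {t : ℝ} (ht : t ∈ Ico (0 : ℝ) 1) :
    psum (radCoeff a j) t
      = (1 - t) ^ (1 + 2 * a) * psum (hyp (a + 1) (a + 1 + j) (j + 1)) t := by
  set f := radCoeff a j with hf
  set p := hyp (a + 1) (a + 1 + j) (j + 1) with hp
  have hfs : DiskSummable f := diskSummable_hyp _ _ _
  have hps : DiskSummable p := diskSummable_hyp _ _ _
  have hppos : ∀ x ∈ Ico (0 : ℝ) 1, 0 < psum p x := by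
    intro x hx
    have hnn : ∀ n, 0 ≤ p n := by
      intro n
      induction n with
      | zero => rw [hp, hyp_zero]; exact zero_le_one
      | succ n ih => rw [hp, hyp_succ]; exact mul_nonneg ih (by positivity)
    refine (hps.summable (abs_lt_one_of_mem hx)).tsum_pos
      (fun n => mul_nonneg (hnn n) (pow_nonneg hx.1 n)) 0 ?_
    rw [hp, hyp_zero]; norm_num
  have hodeF := fun x (hx : x ∈ Ico (0 : ℝ) 1) => radCoeff_ode a j (abs_lt_one_of_mem hx)
  have hodeP := fun x (hx : x ∈ Ico (0 : ℝ) 1) => hyp_ode (A := a + 1) (B := a + 1 + j)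
    (natCast_add_one_add_ne_zero j) (abs_lt_one_of_mem hx)
  have hF := fun x (hx : x ∈ Ico (0 : ℝ) 1) => hfs.hasDerivAt (abs_lt_one_of_mem hx)
  have hF' := fun x (hx : x ∈ Ico (0 : ℝ) 1) => hfs.dcoeff.hasDerivAt (abs_lt_one_of_mem hx)
  have hP := fun x (hx : x ∈ Ico (0 : ℝ) 1) => hps.hasDerivAt (abs_lt_one_of_mem hx)
  have hP' := fun x (hx : x ∈ Ico (0 : ℝ) 1) => hps.dcoeff.hasDerivAt (abs_lt_one_of_mem hx)
  -- the Wronskian, up to a power of `1 - x`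
  set V : ℝ → ℝ := fun x => -(1 + 2 * a) * (psum f x * psum p x)
    + (1 - x) * (psum f x * psum (dcoeff p) x - psum (dcoeff f) x * psum p x) with hV
  set V' : ℝ → ℝ := fun x => -(1 + 2 * a) *
      (psum (dcoeff f) x * psum p x + psum f x * psum (dcoeff p) x)
    - (psum f x * psum (dcoeff p) x - psum (dcoeff f) x * psum p x)
    + (1 - x) * (psum f x * psum (dcoeff (dcoeff p)) x - psum (dcoeff (dcoeff f)) x * psum p x)
    with hV'
  have hVder : ∀ x ∈ Ico (0 : ℝ) 1, HasDerivAt V (V' x) x := by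
    intro x hx
    have h := (((hF x hx).mul (hP x hx)).const_mul (-(1 + 2 * a))).add
      (((hasDerivAt_id x).const_sub 1).mul
        (((hF x hx).mul (hP' x hx)).sub ((hF' x hx).mul (hP x hx))))
    convert! h using 1
    simp only [hV', id, Pi.mul_apply, Pi.sub_apply]
    ring
  have hVode : ∀ x ∈ Ico (0 : ℝ) 1, (j + 1) * V x + x * V' x = 0 := by
    intro x hx
    have h1 := hodeF x hx
    have h2 := hodeP x hx
    simp only [hV, hV']
    linear_combination (psum f x) * h2 - (psum p x) * h1
  have hVzero : ∀ x ∈ Ico (0 : ℝ) 1, V x = 0 := by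
    intro x hx
    rcases hx.1.eq_or_lt with rfl | hx0
    · have h := hVode 0 hx
      rw [zero_mul, add_zero] at h
      exact (mul_eq_zero.1 h).resolve_left (by positivity)
    · have hd : ∀ y ∈ Icc 0 x, HasDerivAt (fun y => y ^ (j + 1) * V y) 0 y := by
        intro y hy
        have hy' : y ∈ Ico (0 : ℝ) 1 := ⟨hy.1, hy.2.trans_lt hx.2⟩
        have h := (hasDerivAt_pow (j + 1) y).mul (hVder y hy')
        convert! h using 1
        simp only [Nat.add_sub_cancel]
        push_cast
        linear_combination (-y ^ j) * hVode y hy'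
      have h := constant_of_has_deriv_right_zero
        (fun y hy => (hd y hy).continuousAt.continuousWithinAt)
        (fun y hy => (hd y (Ico_subset_Icc_self hy)).hasDerivWithinAt) x
        (right_mem_Icc.2 hx0.le)
      simp only [ne_eq, Nat.add_eq_zero_iff, one_ne_zero, and_false, not_false_eq_true, zero_pow,
        zero_mul] at h
      exact (mul_eq_zero.1 h).resolve_left (by positivity)
  have hd : ∀ y ∈ Icc 0 t,
      HasDerivAt (fun y => (1 - y) ^ (-(1 + 2 * a)) * (psum f y / psum p y)) 0 y := by
    intro y hy
    have hy' : y ∈ Ico (0 : ℝ) 1 := ⟨hy.1, hy.2.trans_lt ht.2⟩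
    have h := (hasDerivAt_one_sub_rpow (-(1 + 2 * a)) hy'.2).mul
      ((hF y hy').div (hP y hy') (hppos y hy').ne')
    convert! h using 1
    have hpos : 0 < 1 - y := by linarith [hy'.2]
    have hpw : (1 - y) ^ (-(1 + 2 * a)) = (1 - y) ^ (-(1 + 2 * a) - 1) * (1 - y) := by
      rw [← Real.rpow_add_one hpos.ne']; congr 1; ring
    have hv := hVzero y hy'
    have hne := (hppos y hy').ne'
    simp only [hV, Pi.div_apply] at hv ⊢
    rw [hpw]
    field_simp
    linear_combination ((1 - y) ^ (-(1 + 2 * a) - 1)) * hv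
  have h := constant_of_has_deriv_right_zero
    (fun y hy => (hd y hy).continuousAt.continuousWithinAt)
    (fun y hy => (hd y (Ico_subset_Icc_self hy)).hasDerivWithinAt) t (right_mem_Icc.2 ht.1)
  simp only [psum_zero, hf, hp, radCoeff, hyp_zero, sub_zero, Real.one_rpow, div_one,
    mul_one] at h
  have hpos : 0 < 1 - t := by linarith [ht.2]
  have hne := (hppos t ht).ne'
  rw [Real.rpow_neg hpos.le] at h
  have hpw : (1 - t) ^ (1 + 2 * a) ≠ 0 := by positivity
  rw [inv_mul_eq_div, div_div, div_eq_one_iff_eq (mul_ne_zero hne hpw)] at h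
  rw [hf, radCoeff, h, mul_comm]

end radial

/-! ### The value at 1: Gamma quotients, an Abelian theorem, the binomial series -/

lemma ascPochhammer_eval_eq_prod (s : ℝ) (n : ℕ) :
    (ascPochhammer ℝ n).eval s = ∏ i ∈ Finset.range n, (s + i) := by
  induction n with
  | zero => simp
  | succ n ih => rw [ascPochhammer_succ_eval, Finset.prod_range_succ, ih]

/-- Four instances of Euler's limit `n^s n! / (s)_(n+1) → Γ(s)`; the powers of `n` cancel because `x
+ y = z + w`. The index shift matches the `n + 1` factors in Euler's product. -/
lemma tendsto_ascPochhammer_ratio {x y z w : ℝ} (hx : 0 < x) (hy : 0 < y) (hz : 0 < z)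
    (hw : 0 < w) (h : x + y = z + w) :
    Tendsto (fun n => (ascPochhammer ℝ n).eval x * (ascPochhammer ℝ n).eval y
      / ((ascPochhammer ℝ n).eval z * (ascPochhammer ℝ n).eval w)) atTop
      (𝓝 (Real.Gamma z * Real.Gamma w / (Real.Gamma x * Real.Gamma y))) := by
  rw [← tendsto_add_atTop_iff_nat 1]
  have hlim := ((Real.GammaSeq_tendsto_Gamma z).mul (Real.GammaSeq_tendsto_Gamma w)).div
    ((Real.GammaSeq_tendsto_Gamma x).mul (Real.GammaSeq_tendsto_Gamma y))
    (mul_pos (Real.Gamma_pos_of_pos hx) (Real.Gamma_pos_of_pos hy)).ne'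
  refine hlim.congr' ?_
  filter_upwards [eventually_gt_atTop 0] with n hn
  have hn' : (0 : ℝ) < n := by exact_mod_cast hn
  simp only [Pi.div_apply, Real.GammaSeq, ← ascPochhammer_eval_eq_prod]
  have hpos : ∀ s : ℝ, 0 < s → (ascPochhammer ℝ (n + 1)).eval s ≠ 0 := fun s hs =>
    (ascPochhammer_pos _ _ hs).ne'
  have h1 := hpos x hx
  have h2 := hpos y hy
  have h3 := hpos z hz
  have h4 := hpos w hw
  have hpw : (n : ℝ) ^ x * (n : ℝ) ^ y = (n : ℝ) ^ z * (n : ℝ) ^ w := by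
    rw [← Real.rpow_add hn', ← Real.rpow_add hn', h]
  have h5 : (n : ℝ) ^ x ≠ 0 := by positivity
  have h6 : (n : ℝ) ^ y ≠ 0 := by positivity
  have hf : (n.factorial : ℝ) ≠ 0 := by positivity
  field_simp
  linear_combination (-1 : ℝ) * hpw

/-- An Abelian theorem: asymptotics of coefficients give asymptotics of the series at `1`. -/
lemma tendsto_one_sub_rpow_mul_psum {p d : ℕ → ℝ} (hp : DiskSummable p) (hd : DiskSummable d)
    (hd0 : ∀ n, 0 < d n) {L s : ℝ} (hs : 0 < s)
    (h : Tendsto (fun n => p n / d n) atTop (𝓝 L))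
    (hbin : ∀ t ∈ Ico (0 : ℝ) 1, (1 - t) ^ s * psum d t = 1) :
    Tendsto (fun t => (1 - t) ^ s * psum p t) (𝓝[<] 1) (𝓝 L) := by
  rw [Metric.tendsto_nhds]
  intro ε hε
  obtain ⟨N, hN⟩ := eventually_atTop.1 (Metric.tendsto_nhds.1 h (ε / 2) (by positivity))
  set K : ℝ := ∑ n ∈ Finset.range N, |p n - L * d n| with hK
  have hlim : Tendsto (fun t : ℝ => (1 - t) ^ s * K) (𝓝[<] 1) (𝓝 0) := by
    have h1 : ContinuousAt (fun t : ℝ => (1 - t) ^ s * K) 1 :=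
      ((continuousAt_const.sub continuousAt_id).rpow_const (Or.inr hs.le)).mul continuousAt_const
    have h2 := h1.tendsto
    simp only [sub_self, Real.zero_rpow hs.ne', zero_mul] at h2
    exact h2.mono_left nhdsWithin_le_nhds
  filter_upwards [hlim.eventually (gt_mem_nhds (half_pos hε)),
    Ioo_mem_nhdsLT (zero_lt_one (α := ℝ))] with t ht1 ht2
  have ht : t ∈ Ico (0 : ℝ) 1 := ⟨ht2.1.le, ht2.2⟩
  have ht' := abs_lt_one_of_mem ht
  have hpos : 0 < (1 - t) ^ s := Real.rpow_pos_of_pos (by linarith [ht.2]) _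
  have hsub := (hp.hasSum ht').sub ((hd.hasSum ht').mul_left L)
  -- Termwise majorant: the first `N` terms contribute at most `K`, which the factor `(1-t)^s` kills
  -- in the limit; the others are at most `ε/2` times those of the comparison series.
  have hbd : HasSum (fun n => (if n ∈ Finset.range N then |p n - L * d n| else 0)
      + ε / 2 * (d n * t ^ n)) (K + ε / 2 * psum d t) := by
    refine HasSum.add ?_ ((hd.hasSum ht').mul_left _)
    rw [hK, ← Finset.sum_congr rfl (fun n hn => if_pos hn)]
    exact hasSum_sum_of_ne_finset_zero fun n hn => if_neg hn
  have hle : ‖psum p t - L * psum d t‖ ≤ K + ε / 2 * psum d t := by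
    rw [← hsub.tsum_eq]
    refine tsum_of_norm_bounded hbd fun n => ?_
    have hpow : 0 ≤ t ^ n := pow_nonneg ht.1 n
    have hpow1 : t ^ n ≤ 1 := pow_le_one₀ ht.1 ht.2.le
    have he : p n * t ^ n - L * (d n * t ^ n) = (p n - L * d n) * t ^ n := by ring
    rw [he, Real.norm_eq_abs, abs_mul, abs_of_nonneg hpow]
    by_cases hn : n ∈ Finset.range N
    · rw [if_pos hn]
      have h1 : |p n - L * d n| * t ^ n ≤ |p n - L * d n| :=
        mul_le_of_le_one_right (abs_nonneg _) hpow1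
      have h2 : 0 ≤ ε / 2 * (d n * t ^ n) := by have := (hd0 n).le; positivity
      linarith
    · rw [if_neg hn, zero_add, ← mul_assoc]
      refine mul_le_mul_of_nonneg_right ?_ hpow
      have h1 := hN n (by simpa using hn)
      rw [Real.dist_eq, div_sub' (hd0 n).ne', abs_div, abs_of_pos (hd0 n),
        div_lt_iff₀ (hd0 n), mul_comm (d n)] at h1
      exact h1.le
  rw [Real.dist_eq]
  have hb := hbin t ht
  have he : (1 - t) ^ s * psum p t - L = (1 - t) ^ s * (psum p t - L * psum d t) := by
    linear_combination L * hb
  rw [he, abs_mul, abs_of_pos hpos]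
  calc (1 - t) ^ s * |psum p t - L * psum d t| ≤ (1 - t) ^ s * (K + ε / 2 * psum d t) :=
        mul_le_mul_of_nonneg_left hle hpos.le
    _ = (1 - t) ^ s * K + ε / 2 * ((1 - t) ^ s * psum d t) := by ring
    _ < ε := by rw [hb]; linarith

/-- With parameters `x, 1; 1` the hypergeometric series is the binomial series of `(1-t)^(-x)`. -/
lemma hyp_one_one_eq (x : ℝ) (n : ℕ) :
    hyp x 1 1 n = (n.factorial : ℝ)⁻¹ * (ascPochhammer ℝ n).eval x := by
  rw [hyp, ordinaryHypergeometricCoefficient, mul_assoc, mul_inv_cancel₀, mul_one]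
  exact (ascPochhammer_pos _ _ one_pos).ne'

lemma ring_choose_eq_hyp (x : ℝ) (n : ℕ) : Ring.choose (x + n - 1) n = hyp x 1 1 n := by
  have h := Ring.factorial_nsmul_multichoose_eq_ascPochhammer x n
  rw [Polynomial.ascPochhammer_smeval_eq_eval, nsmul_eq_mul] at h
  rw [hyp_one_one_eq, Ring.choose, ← h, ← mul_assoc, inv_mul_cancel₀ (by positivity), one_mul]
  congr 1; ring

lemma ofReal_hyp_one_one (x : ℝ) (n : ℕ) :
    ((hyp x 1 1 n : ℝ) : ℂ) = Ring.choose ((x : ℂ) + n - 1) n := by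
  rw [← ring_choose_eq_hyp, Complex.ofReal_choose]
  push_cast; rfl

/-- The binomial series for negative exponents. -/
lemma hasSum_one_sub_cpow_neg (x : ℝ) {z : ℂ} (hz : ‖z‖ < 1) :
    HasSum (fun n => ((hyp x 1 1 n : ℝ) : ℂ) * z ^ n) ((1 - z) ^ (-x : ℂ)) := by
  have h := (Complex.one_div_one_sub_cpow_hasFPowerSeriesOnBall_zero x).hasSum (y := z)
    (by simpa [enorm_eq_nnnorm] using! hz)
  rw [zero_add, one_div, ← Complex.cpow_neg] at h
  refine h.congr_fun fun n => ?_
  simp [ofReal_hyp_one_one, mul_comm]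

lemma one_sub_rpow_mul_psum (x : ℝ) {t : ℝ} (ht : t ∈ Ico (0 : ℝ) 1) :
    (1 - t) ^ x * psum (hyp x 1 1) t = 1 := by
  have h := (Real.one_div_one_sub_rpow_hasFPowerSeriesOnBall_zero x).hasSum (y := t)
    (by simpa [enorm_eq_nnnorm] using! abs_lt_one_of_mem ht)
  rw [zero_add] at h
  have h2 : psum (hyp x 1 1) t = 1 / (1 - t) ^ x := by
    rw [← h.tsum_eq, psum]
    refine tsum_congr fun n => ?_
    simp [ring_choose_eq_hyp, mul_comm]
  have : 0 < (1 - t) ^ x := Real.rpow_pos_of_pos (by linarith [ht.2]) _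
  rw [h2]; field_simp

/-- The value at `1` of `F_j`, as a function of `a = α / 2`. -/
def radOne (a : ℝ) (j : ℕ) : ℝ :=
  Real.Gamma (j + 1) * Real.Gamma (1 + 2 * a) / (Real.Gamma (a + 1) * Real.Gamma (a + 1 + j))

lemma radOne_pos {a : ℝ} (ha : 0 < a) (j : ℕ) : 0 < radOne a j := by
  have h1 := Real.Gamma_pos_of_pos (show (0 : ℝ) < j + 1 by positivity)
  have h2 := Real.Gamma_pos_of_pos (show (0 : ℝ) < 1 + 2 * a by positivity)
  have h3 := Real.Gamma_pos_of_pos (show (0 : ℝ) < a + 1 by positivity)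
  have h4 := Real.Gamma_pos_of_pos (show (0 : ℝ) < a + 1 + j by positivity)
  unfold radOne
  positivity

/-- Gauss's summation theorem for `F_j`. -/
lemma tendsto_psum_radCoeff {a : ℝ} (ha : 0 < a) (j : ℕ) :
    Tendsto (psum (radCoeff a j)) (𝓝[<] 1) (𝓝 (radOne a j)) := by
  -- After Euler's transformation the series is compared with `(1-t)^(-(1+2a))`; the Pochhammer
  -- parameters balance since `(a+1) + (a+1+j) = (j+1) + (1+2a)`.
  have h := tendsto_one_sub_rpow_mul_psum (diskSummable_hyp (a + 1) (a + 1 + j) (j + 1))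
    (diskSummable_hyp (1 + 2 * a) 1 1) (fun n => ?_) (s := 1 + 2 * a) (L := radOne a j)
    (by positivity) ?_ (fun t ht => one_sub_rpow_mul_psum _ ht)
  · refine h.congr' ?_
    filter_upwards [Ioo_mem_nhdsLT (zero_lt_one (α := ℝ))] with t ht
    exact (radial_euler ha j ⟨ht.1.le, ht.2⟩).symm
  · rw [hyp_one_one_eq]
    have := ascPochhammer_pos n (1 + 2 * a) (by positivity)
    positivity
  · refine (tendsto_ascPochhammer_ratio (x := a + 1) (y := a + 1 + j) (z := j + 1)
      (w := 1 + 2 * a) (by positivity) (by positivity) (by positivity) (by positivity)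
      (by ring)).congr fun n => ?_
    rw [hyp_one_one_eq, hyp, ordinaryHypergeometricCoefficient]
    have h1 := (ascPochhammer_pos n (1 + 2 * a) (by positivity)).ne'
    have h2 := (ascPochhammer_pos n ((j : ℝ) + 1) (by positivity)).ne'
    field_simp

lemma hypFOne_eq {α : ℝ} (hα : 0 < α) (j : ℕ) : hypFOne α j = radOne (α / 2) j := by
  rw [hypFOne, hypF_eq_psum]
  exact (tendsto_psum_radCoeff (half_pos hα) j).limUnder_eq

/-! ### Poisson type integrals of exponentials -/

lemma gamma_add_nat {s : ℝ} (hs : 0 < s) (n : ℕ) :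
    Real.Gamma (s + n) = (ascPochhammer ℝ n).eval s * Real.Gamma s := by
  induction n with
  | zero => simp
  | succ n ih =>
    rw [Nat.cast_succ, ← add_assoc, Real.Gamma_add_one (by positivity), ih,
      ascPochhammer_succ_eval]
    ring

/-- Identifies the products of binomial coefficients arising from `|(1-w)^(-x)|²` as the
coefficients of a single hypergeometric series. -/
lemma hyp_mul_hyp_shift (x : ℝ) (j n : ℕ) :
    hyp x 1 1 n * hyp x 1 1 (n + j) = hyp x 1 1 j * hyp x (x + j) (j + 1) n := by
  induction n with
  | zero => simp [hyp_zero]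
  | succ n ih =>
    have h1 := hyp_succ x 1 1 n
    have h2 := hyp_succ x 1 1 (n + j)
    have h3 := hyp_succ x (x + j) (j + 1) n
    rw [Nat.add_right_comm, h1, h2, h3]
    push_cast
    have e1 : (1 : ℝ) + n ≠ 0 := by positivity
    have e2 : (1 : ℝ) + (n + j) ≠ 0 := by positivity
    have e3 : (j : ℝ) + 1 + n ≠ 0 := by positivity
    field_simp
    linear_combination ((x + n) * (x + (n + j)) * (1 + n + j)) * ih

lemma integral_exp_int (m : ℤ) :
    ∫ τ in (0 : ℝ)..(2 * Real.pi), Complex.exp (m * (τ * Complex.I))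
      = if m = 0 then 2 * (Real.pi : ℂ) else 0 := by
  split_ifs with h
  · simp [h]
  · have hc : (m : ℂ) * Complex.I ≠ 0 := by simp [h, Complex.I_ne_zero]
    have h1 := integral_exp_mul_complex (a := 0) (b := 2 * Real.pi) hc
    have h2 : ∀ τ : ℝ, (m : ℂ) * (τ * Complex.I) = (m : ℂ) * Complex.I * τ := fun τ => by ring
    simp_rw [h2]
    rw [h1]
    have h3 : (m : ℂ) * Complex.I * ((2 * Real.pi : ℝ) : ℂ) = m * (2 * Real.pi * Complex.I) := by
      push_cast; ring
    rw [h3, Complex.exp_int_mul_two_pi_mul_I]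
    simp

lemma hasSum_mul_integral {w : ℕ → ℂ} (hw : Summable fun n => ‖w n‖) {e : ℕ → ℝ → ℂ}
    (hec : ∀ n, Continuous (e n)) {K : ℝ} (he : ∀ n τ, ‖e n τ‖ ≤ K) {S : ℝ → ℂ}
    (hS : ∀ τ, HasSum (fun n => w n * e n τ) (S τ)) :
    HasSum (fun n => w n * ∫ τ in (0 : ℝ)..(2 * Real.pi), e n τ)
      (∫ τ in (0 : ℝ)..(2 * Real.pi), S τ) := by
  have h := intervalIntegral.hasSum_integral_of_dominated_convergence (a := 0)
    (b := 2 * Real.pi) (μ := MeasureTheory.volume) (F := fun n τ => w n * e n τ) (f := S)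
    (fun n _ => ‖w n‖ * K)
    (fun n => (continuous_const.mul (hec n)).aestronglyMeasurable)
    (fun n => Eventually.of_forall fun τ _ => by
      rw [norm_mul]; exact mul_le_mul_of_nonneg_left (he n τ) (norm_nonneg _))
    (Eventually.of_forall fun τ _ => hw.mul_right K)
    (by simp)
    (Eventually.of_forall fun τ _ => hS τ)
  simpa [intervalIntegral.integral_const_mul] using h

/-- `z e^{-iτ}`. -/
def rot (z : ℂ) (τ : ℝ) : ℂ := z * Complex.exp (-(τ * Complex.I))

lemma norm_rot (z : ℂ) (τ : ℝ) : ‖rot z τ‖ = ‖z‖ := by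
  rw [rot, norm_mul, ← neg_mul, ← Complex.ofReal_neg, Complex.norm_exp_ofReal_mul_I, mul_one]

lemma continuous_rot (z : ℂ) : Continuous (rot z) := by
  unfold rot; fun_prop

lemma summable_norm_binom (x : ℝ) {z : ℂ} (hz : ‖z‖ < 1) :
    Summable fun n => ‖((hyp x 1 1 n : ℝ) : ℂ) * z ^ n‖ := by
  refine (diskSummable_hyp x 1 1 ‖z‖ (norm_nonneg _) hz).congr fun n => ?_
  simp

lemma exp_int_add (m n : ℤ) (τ : ℝ) : Complex.exp (m * (τ * Complex.I))
    * Complex.exp (n * (τ * Complex.I)) = Complex.exp ((m + n : ℤ) * (τ * Complex.I)) := by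
  rw [← Complex.exp_add]; push_cast; ring_nf

lemma norm_exp_int (m : ℤ) (τ : ℝ) : ‖Complex.exp (m * (τ * Complex.I))‖ = 1 := by
  rw [← mul_assoc, ← Complex.ofReal_intCast, ← Complex.ofReal_mul, Complex.norm_exp_ofReal_mul_I]

lemma continuous_exp_int (m : ℤ) :
    Continuous fun τ : ℝ => Complex.exp (m * (τ * Complex.I)) := by fun_prop

lemma rot_pow (z : ℂ) (τ : ℝ) (n : ℕ) :
    rot z τ ^ n = z ^ n * Complex.exp ((-n : ℤ) * (τ * Complex.I)) := by
  rw [rot, mul_pow, ← Complex.exp_nat_mul]; push_cast; ring_nf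

lemma conj_rot_pow (z : ℂ) (τ : ℝ) (n : ℕ) :
    (starRingEnd ℂ) (rot z τ ^ n)
      = (starRingEnd ℂ) z ^ n * Complex.exp ((n : ℤ) * (τ * Complex.I)) := by
  rw [rot_pow, map_mul, map_pow, ← Complex.exp_conj]
  simp

/-- Fourier coefficients of the boundary values of the binomial series on a circle. -/
lemma integral_cpow_rot (x : ℝ) {z : ℂ} (hz : ‖z‖ < 1) (l : ℕ) :
    ∫ τ in (0 : ℝ)..(2 * Real.pi), (1 - rot z τ) ^ (-x : ℂ)
        * Complex.exp ((l : ℤ) * (τ * Complex.I))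
      = 2 * Real.pi * ((hyp x 1 1 l : ℝ) * z ^ l) := by
  have h := hasSum_mul_integral (summable_norm_binom x hz)
    (e := fun n τ => Complex.exp ((-n + l : ℤ) * (τ * Complex.I)))
    (S := fun τ => (1 - rot z τ) ^ (-x : ℂ) * Complex.exp ((l : ℤ) * (τ * Complex.I)))
    (fun n => continuous_exp_int _) (K := 1) (fun n τ => (norm_exp_int _ _).le) ?_
  · rw [← h.tsum_eq, tsum_eq_single l]
    · rw [integral_exp_int, if_pos (by ring)]; ring
    · intro n hn
      rw [integral_exp_int, if_neg (by omega), mul_zero]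
  · intro τ
    have h1 := (hasSum_one_sub_cpow_neg x (z := rot z τ) (by rwa [norm_rot])).mul_right
      (Complex.exp ((l : ℤ) * (τ * Complex.I)))
    refine h1.congr_fun fun n => ?_
    rw [rot_pow, ← exp_int_add]; ring

lemma continuous_cpow_rot (x : ℝ) {z : ℂ} (hz : ‖z‖ < 1) :
    Continuous fun τ => (1 - rot z τ) ^ (-x : ℂ) := by
  refine (continuous_const.sub (continuous_rot z)).cpow continuous_const fun τ => ?_
  rw [sub_eq_add_neg]
  refine Complex.mem_slitPlane_of_norm_lt_one (z := -rot z τ) ?_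
  rwa [norm_neg, norm_rot]

lemma norm_cpow_rot_le (x : ℝ) {z : ℂ} (hz : ‖z‖ < 1) (τ : ℝ) :
    ‖(1 - rot z τ) ^ (-x : ℂ)‖ ≤ ∑' n, ‖((hyp x 1 1 n : ℝ) : ℂ) * z ^ n‖ := by
  rw [← (hasSum_one_sub_cpow_neg x (z := rot z τ) (by rwa [norm_rot])).tsum_eq]
  refine tsum_of_norm_bounded (summable_norm_binom x hz).hasSum fun n => ?_
  rw [norm_mul, norm_mul, norm_pow, norm_pow, norm_rot]

/-- Only the conjugate factor of `|(1-w)^(-x)|²` is expanded; the other stays closed and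
`integral_cpow_rot` evaluates each term, so no double series occurs. -/
lemma hasSum_integral_normSq_cpow_rot (x : ℝ) {z : ℂ} (hz : ‖z‖ < 1) (j : ℕ) :
    HasSum (fun n => 2 * Real.pi * (((hyp x 1 1 n * hyp x 1 1 (n + j) : ℝ) : ℂ)
        * ((‖z‖ ^ 2 : ℝ) : ℂ) ^ n * z ^ j))
      (∫ τ in (0 : ℝ)..(2 * Real.pi), ((‖(1 - rot z τ) ^ (-x : ℂ)‖ ^ 2 : ℝ) : ℂ)
        * Complex.exp ((j : ℤ) * (τ * Complex.I))) := by
  have hw : Summable fun n => ‖((hyp x 1 1 n : ℝ) : ℂ) * (starRingEnd ℂ) z ^ n‖ :=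
    summable_norm_binom x (by rwa [Complex.norm_conj])
  have h := hasSum_mul_integral hw
    (e := fun n τ => (1 - rot z τ) ^ (-x : ℂ) * Complex.exp ((n + j : ℕ) * (τ * Complex.I)))
    (S := fun τ => ((‖(1 - rot z τ) ^ (-x : ℂ)‖ ^ 2 : ℝ) : ℂ)
      * Complex.exp ((j : ℤ) * (τ * Complex.I)))
    (fun n => (continuous_cpow_rot x hz).mul (by fun_prop))
    (K := ∑' n, ‖((hyp x 1 1 n : ℝ) : ℂ) * z ^ n‖) ?_ ?_
  · refine h.congr_fun fun n => ?_
    have h1 := integral_cpow_rot x hz (n + j)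
    simp only [Int.cast_natCast] at h1
    rw [h1, Complex.ofReal_pow, ← Complex.mul_conj', pow_add, mul_pow]
    push_cast
    ring
  · intro n τ
    have h1 := norm_exp_int (n + j : ℕ) τ
    rw [Int.cast_natCast] at h1
    rw [norm_mul, h1, mul_one]
    exact norm_cpow_rot_le x hz τ
  · intro τ
    have h1 := (hasSum_one_sub_cpow_neg x (z := rot z τ) (by rwa [norm_rot])).map
      (starRingEnd ℂ) Complex.continuous_conj
    have h2 := (h1.mul_left ((1 - rot z τ) ^ (-x : ℂ))).mul_right
      (Complex.exp ((j : ℤ) * (τ * Complex.I)))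
    rw [Complex.mul_conj'] at h2
    rw [Complex.ofReal_pow]
    refine h2.congr_fun fun n => ?_
    simp only [Function.comp_apply]
    rw [map_mul, Complex.conj_ofReal, conj_rot_pow]
    have h3 := exp_int_add n j τ
    push_cast at h3 ⊢
    rw [← h3]; ring

lemma kernelK_rot {α : ℝ} {z : ℂ} (hz : ‖z‖ < 1) (τ : ℝ) :
    kernelK α (rot z τ) = Real.Gamma (α / 2 + 1) ^ 2 / Real.Gamma (1 + α)
      * (1 - ‖z‖ ^ 2) ^ (1 + 2 * (α / 2))
      * ‖(1 - rot z τ) ^ (-((α / 2 + 1 : ℝ) : ℂ))‖ ^ 2 := by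
  have hne : 0 < ‖1 - rot z τ‖ := by
    rw [norm_pos_iff, sub_ne_zero]
    intro h
    have := norm_rot z τ
    rw [← h, norm_one] at this
    linarith
  have hpw : (‖1 - rot z τ‖ ^ (-(α / 2 + 1))) ^ 2 = (‖1 - rot z τ‖ ^ (α + 2))⁻¹ := by
    rw [← Real.rpow_natCast, ← Real.rpow_mul hne.le, ← Real.rpow_neg hne.le]
    congr 1; push_cast; ring
  rw [kernelK, norm_rot, ← Complex.ofReal_neg, Complex.norm_cpow_real, hpw, mul_assoc,
    div_eq_mul_inv (_ ^ (α + 1))]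
  congr 3
  ring

/-- The Poisson type extension of `e^{ijτ}`. -/
lemma integral_kernelK_exp {α : ℝ} (hα : 0 < α) {z : ℂ} (hz : ‖z‖ < 1) (j : ℕ) :
    (1 / (2 * Real.pi) : ℂ) * ∫ τ in (0 : ℝ)..(2 * Real.pi),
      (kernelK α (rot z τ) : ℂ) * Complex.exp ((j : ℤ) * (τ * Complex.I))
      = ((psum (radCoeff (α / 2) j) (‖z‖ ^ 2) / radOne (α / 2) j : ℝ) : ℂ) * z ^ j := by
  set a := α / 2 with ha
  have ha0 : 0 < a := half_pos hα
  have ht : ‖z‖ ^ 2 ∈ Ico (0 : ℝ) 1 := ⟨by positivity, by nlinarith [norm_nonneg z]⟩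
  have h := hasSum_integral_normSq_cpow_rot (a + 1) hz j
  have hs := (diskSummable_hyp (a + 1) (a + 1 + j) (j + 1)).hasSum (abs_lt_one_of_mem ht)
  have hs' := ((Complex.hasSum_ofReal.2 hs).mul_left
    (2 * (Real.pi : ℂ) * (hyp (a + 1) 1 1 j : ℝ))).mul_right (z ^ j)
  have hI := h.unique (hs'.congr_fun fun n => by
    rw [hyp_mul_hyp_shift]; push_cast; ring)
  set p := psum (hyp (a + 1) (a + 1 + j) (j + 1)) (‖z‖ ^ 2) with hp
  have he := radial_euler ha0 j ht
  rw [← hp] at he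
  have hint : ∫ τ in (0 : ℝ)..(2 * Real.pi),
      (kernelK α (rot z τ) : ℂ) * Complex.exp ((j : ℤ) * (τ * Complex.I))
      = ((Real.Gamma (a + 1) ^ 2 / Real.Gamma (1 + α) * (1 - ‖z‖ ^ 2) ^ (1 + 2 * a) : ℝ) : ℂ)
        * (2 * (Real.pi : ℂ) * (hyp (a + 1) 1 1 j : ℝ) * (p : ℂ) * z ^ j) := by
    rw [← hI, ← intervalIntegral.integral_const_mul]
    refine intervalIntegral.integral_congr fun τ _ => ?_
    simp only [kernelK_rot hz τ, ← ha]
    push_cast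
    ring
  rw [hint, he]
  have hpi : (Real.pi : ℂ) ≠ 0 := by exact_mod_cast Real.pi_ne_zero
  -- The normalization of the kernel is exactly what makes the constant equal to `1 / F_j(1)`.
  have hval : Real.Gamma (a + 1) ^ 2 / Real.Gamma (1 + α) * hyp (a + 1) 1 1 j * radOne a j = 1 := by
    have hα2 : α = 2 * a := by rw [ha]; ring
    have h1 := (Real.Gamma_pos_of_pos (show (0 : ℝ) < 1 + 2 * a by positivity)).ne'
    have h2 := (Real.Gamma_pos_of_pos (show (0 : ℝ) < a + 1 by positivity)).ne'
    have h3 := (ascPochhammer_pos j (a + 1) (by positivity)).ne'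
    rw [hyp_one_one_eq, radOne, gamma_add_nat (by positivity), Real.Gamma_nat_eq_factorial, hα2]
    field_simp
  have hr := (radOne_pos ha0 j).ne'
  have hval' : Real.Gamma (a + 1) ^ 2 / Real.Gamma (1 + α) * hyp (a + 1) 1 1 j
      = 1 / radOne a j := by rw [eq_div_iff hr, hval]
  calc _ = ((Real.Gamma (a + 1) ^ 2 / Real.Gamma (1 + α) * hyp (a + 1) 1 1 j : ℝ) : ℂ)
        * (((1 - ‖z‖ ^ 2) ^ (1 + 2 * a) : ℝ) : ℂ) * p * z ^ j := by
        push_cast; field_simp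
    _ = _ := by rw [hval']; push_cast; ring

/-- The solution in closed form. -/
def closedForm (a : ℝ) (k : ℕ) (c : ℝ) (z : ℂ) : ℂ :=
  (psum (radCoeff a 1) (‖z‖ ^ 2) : ℂ) * z
    + c * (psum (radCoeff a k) (‖z‖ ^ 2) : ℂ) * (starRingEnd ℂ) z ^ k

lemma continuous_kernelK_rot {α : ℝ} {z : ℂ} (hz : ‖z‖ < 1) :
    Continuous fun τ => kernelK α (rot z τ) := by
  simp_rw [kernelK_rot hz]
  exact continuous_const.mul ((continuous_cpow_rot (α / 2 + 1) hz).norm.pow 2)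

lemma poissonExt_boundaryMap {α : ℝ} (hα : 0 < α) (k : ℕ) (c : ℝ) {z : ℂ} (hz : ‖z‖ < 1) :
    poissonExt α (boundaryMap α k c) z = closedForm (α / 2) k c z := by
  have hplus := integral_kernelK_exp hα hz 1
  have hk := congrArg (starRingEnd ℂ) (integral_kernelK_exp hα hz k)
  -- The kernel is real, so the negative frequency is the complex conjugate of the positive one.
  have hminus : (1 / (2 * Real.pi) : ℂ) * ∫ τ in (0 : ℝ)..(2 * Real.pi),
      (kernelK α (rot z τ) : ℂ) * Complex.exp ((-k : ℤ) * (τ * Complex.I))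
      = ((psum (radCoeff (α / 2) k) (‖z‖ ^ 2) / radOne (α / 2) k : ℝ) : ℂ)
        * (starRingEnd ℂ) z ^ k := by
    rw [map_mul, map_mul, map_pow, Complex.conj_ofReal, intervalIntegral.integral_of_le Real.two_pi_pos.le,
      ← integral_conj, ← intervalIntegral.integral_of_le Real.two_pi_pos.le] at hk
    rw [← hk]
    congr 1
    · simpa using (map_ofNat (starRingEnd ℂ) 2).symm
    · refine intervalIntegral.integral_congr fun τ _ => ?_
      simp only [map_mul, Complex.conj_ofReal, ← Complex.exp_conj]
      simp
  have hc := continuous_kernelK_rot (α := α) hz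
  have hint : ∀ m : ℤ, IntervalIntegrable
      (fun τ => (kernelK α (rot z τ) : ℂ) * Complex.exp (m * (τ * Complex.I)))
      MeasureTheory.volume 0 (2 * Real.pi) := fun m =>
    ((Complex.continuous_ofReal.comp hc).mul (continuous_exp_int m)).intervalIntegrable _ _
  have hsplit : ∫ τ in (0 : ℝ)..(2 * Real.pi), (kernelK α (z * Complex.exp (-(τ * Complex.I))) : ℂ)
        * boundaryMap α k c (Circle.exp τ)
      = (hypFOne α 1 : ℂ) * (∫ τ in (0 : ℝ)..(2 * Real.pi),
          (kernelK α (rot z τ) : ℂ) * Complex.exp (((1 : ℕ) : ℤ) * (τ * Complex.I)))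
        + (c : ℂ) * (hypFOne α k : ℂ) * ∫ τ in (0 : ℝ)..(2 * Real.pi),
          (kernelK α (rot z τ) : ℂ) * Complex.exp ((-k : ℤ) * (τ * Complex.I)) := by
    rw [← intervalIntegral.integral_const_mul, ← intervalIntegral.integral_const_mul,
      ← intervalIntegral.integral_add ((hint _).const_mul _) ((hint _).const_mul _)]
    refine intervalIntegral.integral_congr fun τ _ => ?_
    have h1 : (Circle.exp τ : ℂ) ^ (-(k : ℤ)) = Complex.exp ((-k : ℤ) * (τ * Complex.I)) := by
      rw [Circle.coe_exp, ← Complex.exp_int_mul]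
    simp only [boundaryMap, h1, rot]
    rw [Circle.coe_exp]
    push_cast
    ring_nf
  have h1 := (radOne_pos (half_pos hα) 1).ne'
  have h2 := (radOne_pos (half_pos hα) k).ne'
  have h1' : (radOne (α / 2) 1 : ℂ) ≠ 0 := by exact_mod_cast h1
  have h2' : (radOne (α / 2) k : ℂ) ≠ 0 := by exact_mod_cast h2
  rw [poissonExt, hsplit, hypFOne_eq hα, hypFOne_eq hα, mul_add, mul_left_comm, hplus,
    mul_left_comm _ ((c : ℂ) * _), hminus, closedForm]
  push_cast
  field_simp

/-! ### Wirtinger calculus and the differential equation -/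

/-- The real linear map `v ↦ p v + q v̄`. -/
def wirt (p q : ℂ) : ℂ →L[ℝ] ℂ :=
  p • ContinuousLinearMap.id ℝ ℂ + q • (Complex.conjCLE : ℂ →L[ℝ] ℂ)

lemma wirt_apply (p q v : ℂ) : wirt p q v = p * v + q * (starRingEnd ℂ) v := by
  simp [wirt]

lemma dz_eq {u : ℂ → ℂ} {p q z : ℂ} (h : HasFDerivAt u (wirt p q) z) : dz u z = p := by
  rw [dz, h.fderiv, wirt_apply, wirt_apply, map_one, Complex.conj_I]
  linear_combination (-(p - q) / 2) * Complex.I_sq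

lemma dzbar_eq {u : ℂ → ℂ} {p q z : ℂ} (h : HasFDerivAt u (wirt p q) z) : dzbar u z = q := by
  rw [dzbar, h.fderiv, wirt_apply, wirt_apply, map_one, Complex.conj_I]
  linear_combination ((p - q) / 2) * Complex.I_sq

lemma hasWirt_id (z : ℂ) : HasFDerivAt (fun z : ℂ => z) (wirt 1 0) z := by
  convert! hasFDerivAt_id (𝕜 := ℝ) z using 1
  ext v; simp [wirt_apply]

lemma hasWirt_conj_pow (k : ℕ) (z : ℂ) :
    HasFDerivAt (fun z : ℂ => (starRingEnd ℂ) z ^ k)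
      (wirt 0 (k * (starRingEnd ℂ) z ^ (k - 1))) z := by
  have h := ((hasDerivAt_pow k ((starRingEnd ℂ) z)).hasFDerivAt.restrictScalars ℝ).comp z
    (Complex.conjCLE : ℂ →L[ℝ] ℂ).hasFDerivAt
  convert! h using 1
  refine ContinuousLinearMap.ext fun v => ?_
  simp [wirt_apply, mul_comm]

lemma hasWirt_add {u v : ℂ → ℂ} {p q r s z : ℂ} (hu : HasFDerivAt u (wirt p q) z)
    (hv : HasFDerivAt v (wirt r s) z) :
    HasFDerivAt (fun z => u z + v z) (wirt (p + r) (q + s)) z := by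
  convert! hu.add hv using 1
  refine ContinuousLinearMap.ext fun v => ?_
  simp [wirt_apply]; ring

lemma hasWirt_mul {u v : ℂ → ℂ} {p q r s z : ℂ} (hu : HasFDerivAt u (wirt p q) z)
    (hv : HasFDerivAt v (wirt r s) z) :
    HasFDerivAt (fun z => u z * v z) (wirt (p * v z + u z * r) (q * v z + u z * s)) z := by
  convert! hu.mul hv using 1
  refine ContinuousLinearMap.ext fun v => ?_
  simp [wirt_apply]; ring

lemma hasWirt_const_mul {u : ℂ → ℂ} {p q z : ℂ} (hu : HasFDerivAt u (wirt p q) z)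
    (c : ℂ) : HasFDerivAt (fun z => c * u z) (wirt (c * p) (c * q)) z := by
  convert! hu.const_mul c using 1
  refine ContinuousLinearMap.ext fun v => ?_
  simp [wirt_apply]; ring

lemma hasWirt_radial {g : ℝ → ℝ} {g' : ℝ} {z : ℂ} (hg : HasDerivAt g g' (‖z‖ ^ 2)) :
    HasFDerivAt (fun z : ℂ => (g (‖z‖ ^ 2) : ℂ)) (wirt (g' * (starRingEnd ℂ) z) (g' * z)) z := by
  have h1 := hg.hasFDerivAt.comp z (hasStrictFDerivAt_norm_sq z).hasFDerivAt
  have h2 := Complex.ofRealCLM.hasFDerivAt.comp z h1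
  convert! h2 using 1
  refine ContinuousLinearMap.ext fun v => ?_
  apply Complex.ext <;> simp [wirt_apply] <;> ring

lemma norm_sq_mem {z : ℂ} (hz : ‖z‖ < 1) : ‖z‖ ^ 2 ∈ Ico (0 : ℝ) 1 :=
  ⟨by positivity, by nlinarith [norm_nonneg z]⟩

section closedForm

variable (a : ℝ) (k : ℕ) (c : ℝ)

/-- `∂u/∂z` for `u = closedForm a k c`. -/
def closedFormZ (z : ℂ) : ℂ :=
  psum (dcoeff (radCoeff a 1)) (‖z‖ ^ 2) * (starRingEnd ℂ) z * z + psum (radCoeff a 1) (‖z‖ ^ 2)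
    + c * (psum (dcoeff (radCoeff a k)) (‖z‖ ^ 2) * (starRingEnd ℂ) z * (starRingEnd ℂ) z ^ k)

/-- `∂u/∂z̄` for `u = closedForm a k c`. -/
def closedFormZbar (z : ℂ) : ℂ :=
  psum (dcoeff (radCoeff a 1)) (‖z‖ ^ 2) * (z * z)
    + c * (psum (dcoeff (radCoeff a k)) (‖z‖ ^ 2) * (z * (starRingEnd ℂ) z ^ k)
      + k * (psum (radCoeff a k) (‖z‖ ^ 2) * (starRingEnd ℂ) z ^ (k - 1)))

variable {z : ℂ} (hz : ‖z‖ < 1)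

include hz

lemma hasWirt_psum (a : ℝ) (j : ℕ) :
    HasFDerivAt (fun z : ℂ => (psum (radCoeff a j) (‖z‖ ^ 2) : ℂ))
      (wirt (psum (dcoeff (radCoeff a j)) (‖z‖ ^ 2) * (starRingEnd ℂ) z)
        (psum (dcoeff (radCoeff a j)) (‖z‖ ^ 2) * z)) z :=
  hasWirt_radial ((diskSummable_hyp _ _ _).hasDerivAt (abs_lt_one_of_mem (norm_sq_mem hz)))

lemma hasWirt_psum_dcoeff (a : ℝ) (j : ℕ) :
    HasFDerivAt (fun z : ℂ => (psum (dcoeff (radCoeff a j)) (‖z‖ ^ 2) : ℂ))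
      (wirt (psum (dcoeff (dcoeff (radCoeff a j))) (‖z‖ ^ 2) * (starRingEnd ℂ) z)
        (psum (dcoeff (dcoeff (radCoeff a j))) (‖z‖ ^ 2) * z)) z :=
  hasWirt_radial ((diskSummable_hyp _ _ _).dcoeff.hasDerivAt
    (abs_lt_one_of_mem (norm_sq_mem hz)))

lemma hasWirt_closedForm :
    HasFDerivAt (closedForm a k c) (wirt (closedFormZ a k c z) (closedFormZbar a k c z)) z := by
  have h := hasWirt_add (hasWirt_mul (hasWirt_psum hz a 1) (hasWirt_id z))
    (hasWirt_const_mul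
      (hasWirt_mul (hasWirt_psum hz a k) (hasWirt_conj_pow k z)) c)
  convert! h using 1
  · funext w; simp only [closedForm]; ring
  · congr 1
    · simp only [closedFormZ]; ring
    · simp only [closedFormZbar]; ring

lemma dz_closedFormZbar : dz (closedFormZbar a k c) z
    = psum (dcoeff (dcoeff (radCoeff a 1))) (‖z‖ ^ 2) * (starRingEnd ℂ) z * (z * z)
      + psum (dcoeff (radCoeff a 1)) (‖z‖ ^ 2) * (2 * z)
      + c * (psum (dcoeff (dcoeff (radCoeff a k))) (‖z‖ ^ 2) * (starRingEnd ℂ) z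
          * (z * (starRingEnd ℂ) z ^ k)
        + psum (dcoeff (radCoeff a k)) (‖z‖ ^ 2) * (starRingEnd ℂ) z ^ k
        + k * (psum (dcoeff (radCoeff a k)) (‖z‖ ^ 2) * (starRingEnd ℂ) z
          * (starRingEnd ℂ) z ^ (k - 1))) := by
  have h := hasWirt_add
    (hasWirt_mul (hasWirt_psum_dcoeff hz a 1)
      (hasWirt_mul (hasWirt_id z) (hasWirt_id z)))
    (hasWirt_const_mul (hasWirt_add
      (hasWirt_mul (hasWirt_psum_dcoeff hz a k)
        (hasWirt_mul (hasWirt_id z) (hasWirt_conj_pow k z)))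
      (hasWirt_const_mul
        (hasWirt_mul (hasWirt_psum hz a k) (hasWirt_conj_pow (k - 1) z)) k)) c)
  refine (dz_eq (u := closedFormZbar a k c) h).trans ?_
  ring

/-- Up to the factor `(1-|z|²)^(-α-1)`, the operator gives `z`, respectively `c z̄^k`, times the
hypergeometric equation of `F_1`, respectively `F_k`, at `|z|²`. -/
lemma opT_closedForm (α : ℝ) (hk : 1 ≤ k) : opT α (closedForm (α / 2) k c) z = 0 := by
  set a := α / 2 with ha
  have hev : dzbar (closedForm a k c) =ᶠ[𝓝 z] closedFormZbar a k c := by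
    filter_upwards [(isOpen_lt continuous_norm continuous_const).mem_nhds hz] with w hw
    exact dzbar_eq (hasWirt_closedForm a k c hw)
  have hdd : dz (dzbar (closedForm a k c)) z = dz (closedFormZbar a k c) z := by
    rw [dz, dz, hev.fderiv_eq]
  have ht := norm_sq_mem hz
  have hF := congrArg (fun x : ℝ => (x : ℂ)) (radCoeff_ode a 1 (abs_lt_one_of_mem ht))
  have hG := congrArg (fun x : ℝ => (x : ℂ)) (radCoeff_ode a k (abs_lt_one_of_mem ht))
  have hpos : 0 < 1 - ‖z‖ ^ 2 := by linarith [ht.2]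
  have hpw : (1 - ‖z‖ ^ 2) ^ (-α) = (1 - ‖z‖ ^ 2) ^ (-α - 1) * (1 - ‖z‖ ^ 2) := by
    rw [← Real.rpow_add_one hpos.ne']; congr 1; ring
  have hzz : (‖z‖ : ℂ) ^ 2 = z * (starRingEnd ℂ) z := (Complex.mul_conj' z).symm
  have hα : (α : ℂ) = 2 * (a : ℂ) := by rw [ha]; push_cast; ring
  obtain ⟨m, rfl⟩ : ∃ m, k = m + 1 := ⟨k - 1, by omega⟩
  rw [opT, hdd, dz_closedFormZbar _ _ _ hz, dz_eq (hasWirt_closedForm a _ c hz),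
    dzbar_eq (hasWirt_closedForm a _ c hz), hpw, closedForm, closedFormZ, closedFormZbar]
  generalize (1 - ‖z‖ ^ 2) ^ (-α - 1) = Q
  push_cast at hF hG ⊢
  rw [hzz] at hF hG ⊢
  rw [hα]
  linear_combination (Q * z) * hF + (Q * c * (starRingEnd ℂ) z ^ (m + 1)) * hG

end closedForm

lemma contDiffOn_closedForm (a : ℝ) (k : ℕ) (c : ℝ) :
    ContDiffOn ℝ 2 (closedForm a k c) (Metric.ball 0 1) := by
  intro z hz
  rw [mem_ball_zero_iff] at hz
  have hp : ∀ j, ContDiffAt ℝ 2 (fun z : ℂ => (psum (radCoeff a j) (‖z‖ ^ 2) : ℂ)) z := by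
    intro j
    have h1 : ContDiffAt ℝ 2 (psum (radCoeff a j)) (‖z‖ ^ 2) :=
      ((diskSummable_hyp _ _ _).analyticAt (abs_lt_one_of_mem (norm_sq_mem hz))).contDiffAt
    exact Complex.ofRealCLM.contDiff.contDiffAt.comp z
      (h1.comp z (contDiff_norm_sq ℝ).contDiffAt)
  have hconj : ContDiffAt ℝ 2 (fun z : ℂ => (starRingEnd ℂ) z ^ k) z :=
    ((Complex.conjCLE : ℂ →L[ℝ] ℂ).contDiff.pow k).contDiffAt
  exact (((hp 1).mul contDiffAt_id).add
    ((contDiffAt_const.mul (hp k)).mul hconj)).contDiffWithinAt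

lemma isRealKernelHarmonic_of_eqOn {α : ℝ} {k : ℕ} (hk : 1 ≤ k) {c : ℝ} {u : ℂ → ℂ}
    (hu : EqOn u (closedForm (α / 2) k c) (Metric.ball 0 1)) : IsRealKernelHarmonic α u := by
  refine ⟨(contDiffOn_closedForm _ k c).congr hu, fun z hz => ?_⟩
  have hev : ∀ w ∈ Metric.ball (0 : ℂ) 1, u =ᶠ[𝓝 w] closedForm (α / 2) k c := fun w hw =>
    hu.eventuallyEq_of_mem (Metric.isOpen_ball.mem_nhds hw)
  have h2 : dzbar u =ᶠ[𝓝 z] dzbar (closedForm (α / 2) k c) := by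
    filter_upwards [Metric.isOpen_ball.mem_nhds hz] with w hw
    rw [dzbar, dzbar, (hev w hw).fderiv_eq]
  have h := opT_closedForm k c (mem_ball_zero_iff.1 hz) α hk
  rw [opT] at h ⊢
  have e1 : dz u z = dz (closedForm (α / 2) k c) z := by rw [dz, dz, (hev z hz).fderiv_eq]
  have e3 : dz (dzbar u) z = dz (dzbar (closedForm (α / 2) k c)) z := by
    rw [dz, dz, h2.fderiv_eq]
  rw [hu hz, e1, h2.eq_of_nhds, e3, h]

/-! ### Strong monotonicity on the disk -/

lemma radOne_le_psum {a : ℝ} {j : ℕ} (ha0 : 0 < a) (ha1 : a ≤ 1) (hj : 1 ≤ j) {t : ℝ}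
    (ht : t ∈ Ico (0 : ℝ) 1) : radOne a j ≤ psum (radCoeff a j) t := by
  have hder := fun x (hx : x ∈ Ico (0 : ℝ) 1) =>
    (diskSummable_hyp (-a) (j - a) (j + 1)).hasDerivAt (abs_lt_one_of_mem hx)
  have hanti : AntitoneOn (psum (radCoeff a j)) (Ico 0 1) := by
    refine antitoneOn_of_deriv_nonpos (convex_Ico 0 1)
      (fun x hx => (hder x hx).continuousAt.continuousWithinAt)
      (fun x hx => (hder x (interior_subset hx)).differentiableAt.differentiableWithinAt)
      fun x hx => ?_
    rw [(hder x (interior_subset hx)).deriv]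
    exact psum_dcoeff_radCoeff_nonpos ha0 ha1 hj (interior_subset hx)
  refine le_of_tendsto (tendsto_psum_radCoeff ha0 j) ?_
  filter_upwards [Ioo_mem_nhdsLT ht.2] with s hs
  exact hanti ht ⟨ht.1.trans hs.1.le, hs.2⟩ hs.1.le

/-- The differential of the closed form has positive symmetric part, uniformly in the disk. -/
lemma re_closedFormZ_sub_norm {a : ℝ} {k : ℕ} (ha0 : 0 < a) (ha1 : a ≤ 1) (hk : 1 ≤ k) {c : ℝ}
    (hc : |c| * k ≤ a) {z : ℂ} (hz : ‖z‖ < 1) :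
    (a - |c| * k) * radOne a 1 ≤ (closedFormZ a k c z).re - ‖closedFormZbar a k c z‖ := by
  have ht := norm_sq_mem hz
  have hk' : (1 : ℝ) ≤ k := by exact_mod_cast hk
  set F := psum (radCoeff a 1) (‖z‖ ^ 2) with hF
  set F' := psum (dcoeff (radCoeff a 1)) (‖z‖ ^ 2) with hF'
  set G := psum (radCoeff a k) (‖z‖ ^ 2) with hG
  set G' := psum (dcoeff (radCoeff a k)) (‖z‖ ^ 2) with hG'
  have f1 : radOne a 1 ≤ F := radOne_le_psum ha0 ha1 le_rfl ht
  have g1 : 0 < G := (radOne_pos ha0 k).trans_le (radOne_le_psum ha0 ha1 hk ht)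
  have f2 : F' ≤ 0 := psum_dcoeff_radCoeff_nonpos ha0 ha1 le_rfl ht
  have g2 : G' ≤ 0 := psum_dcoeff_radCoeff_nonpos ha0 ha1 hk ht
  have f3 := radial_logDeriv_bound ha0 ha1 le_rfl ht
  have g3 := radial_logDeriv_bound ha0 ha1 hk ht
  have gf : G ≤ F := psum_radCoeff_anti ha0 ha1 le_rfl hk ht
  rw [← hF, ← hF'] at f3
  rw [← hG, ← hG'] at g3
  obtain ⟨m, rfl⟩ : ∃ m, k = m + 1 := ⟨k - 1, by omega⟩
  set R := ‖z‖ ^ m with hR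
  have hR0 : 0 ≤ R := by positivity
  have hR1 : R ≤ 1 := pow_le_one₀ (norm_nonneg z) hz.le
  have hzz : (starRingEnd ℂ) z * z = ((‖z‖ ^ 2 : ℝ) : ℂ) := by
    rw [mul_comm, Complex.mul_conj']; push_cast; rfl
  set t := ‖z‖ ^ 2 with htdef
  have h1 : (closedFormZ a (m + 1) c z).re ≥ F' * t + F + |c| * (G' * (R * t)) := by
    have e : closedFormZ a (m + 1) c z = ((F' * t + F : ℝ) : ℂ)
        + c * (G' * (starRingEnd ℂ) z * (starRingEnd ℂ) z ^ (m + 1)) := by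
      rw [closedFormZ, mul_assoc, hzz]; push_cast; rfl
    rw [e, Complex.add_re, Complex.ofReal_re]
    have hn := Complex.abs_re_le_norm (c * (G' * (starRingEnd ℂ) z * (starRingEnd ℂ) z ^ (m + 1)))
    have hn2 : ‖(c : ℂ) * (G' * (starRingEnd ℂ) z * (starRingEnd ℂ) z ^ (m + 1))‖
        = -(|c| * (G' * (R * t))) := by
      rw [norm_mul, norm_mul, norm_mul, norm_pow, Complex.norm_conj, Complex.norm_real,
        Complex.norm_real, Real.norm_eq_abs, Real.norm_eq_abs, abs_of_nonpos g2, hR, htdef]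
      ring
    rw [hn2] at hn
    linarith [neg_le_of_abs_le hn]
  have h2 : ‖closedFormZbar a (m + 1) c z‖ ≤ -F' * t + |c| * (R * (G' * t + (m + 1) * G)) := by
    have e : closedFormZbar a (m + 1) c z = F' * (z * z)
        + c * ((starRingEnd ℂ) z ^ m * ((G' * t + (m + 1) * G : ℝ) : ℂ)) := by
      rw [closedFormZbar]
      push_cast
      have : ((t : ℝ) : ℂ) = (starRingEnd ℂ) z * z := hzz.symm
      rw [this]; ring
    -- This sign allows the norm to be computed without loss, so that the terms in `G'` cancel
    -- between the bounds `h1` and `h2`.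
    have hnn : 0 ≤ G' * t + (m + 1) * G := by
      push_cast at g3
      have : 0 ≤ (m + 1 + a) * G := by positivity
      linarith
    rw [e]
    refine (norm_add_le _ _).trans (le_of_eq ?_)
    rw [norm_mul, norm_mul, norm_mul, norm_mul, norm_pow, Complex.norm_conj, Complex.norm_real,
      Complex.norm_real, Complex.norm_real, Real.norm_eq_abs, Real.norm_eq_abs, Real.norm_eq_abs,
      abs_of_nonpos f2, abs_of_nonneg hnn, hR, htdef]
    ring
  have h3 : |c| * (R * ((m + 1) * G)) ≤ |c| * (m + 1) * F := by
    have : R * G ≤ 1 * F := mul_le_mul hR1 gf g1.le zero_le_one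
    calc |c| * (R * ((m + 1) * G)) = |c| * (m + 1) * (R * G) := by ring
      _ ≤ |c| * (m + 1) * (1 * F) := by gcongr
      _ = _ := by ring
  push_cast at hc f3 ⊢
  have h4 : (a - |c| * (m + 1)) * radOne a 1 ≤ (a - |c| * (m + 1)) * F :=
    mul_le_mul_of_nonneg_left f1 (by linarith)
  linarith

/-- A map of a convex set whose differential has positive symmetric part is strongly monotone. -/
lemma expanding_of_wirt {s : Set ℂ} (hs : Convex ℝ s) {u p q : ℂ → ℂ} {δ : ℝ}
    (hu : ∀ z ∈ s, HasFDerivAt u (wirt (p z) (q z)) z) (hδ : ∀ z ∈ s, δ ≤ (p z).re - ‖q z‖)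
    {z w : ℂ} (hz : z ∈ s) (hw : w ∈ s) : δ * ‖z - w‖ ≤ ‖u z - u w‖ := by
  rcases eq_or_ne z w with rfl | hne
  · simp
  set v := z - w with hv
  have hvpos : 0 < ‖v‖ := norm_pos_iff.2 (sub_ne_zero.2 hne)
  -- Mean value theorem for `Re(v̄ u)` along the segment from `w` to `z`; its derivative is `|v|² Re
  -- p + Re(q v̄²) ≥ δ|v|²`.
  set ℓ : ℂ →L[ℝ] ℝ := Complex.reCLM.comp (wirt ((starRingEnd ℂ) v) 0) with hℓ
  have hℓa : ∀ x, ℓ x = ((starRingEnd ℂ) v * x).re := by intro x; simp [hℓ, wirt_apply]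
  have hmem : ∀ r ∈ Icc (0 : ℝ) 1, w + r * v ∈ s := by
    intro r hr
    have := hs.add_smul_sub_mem hw hz hr
    simpa [hv] using this
  have hder : ∀ r ∈ Icc (0 : ℝ) 1, HasDerivAt (fun r : ℝ => ℓ (u (w + r * v)))
      (ℓ (wirt (p (w + r * v)) (q (w + r * v)) v)) r := by
    intro r hr
    have h1 : HasDerivAt (fun r : ℝ => w + (r : ℂ) * v) v r := by
      simpa using ((Complex.ofRealCLM.hasDerivAt (x := r)).mul_const v).const_add w
    exact ℓ.hasFDerivAt.comp_hasDerivAt r ((hu _ (hmem r hr)).comp_hasDerivAt r h1)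
  obtain ⟨r, hr, hslope⟩ := exists_hasDerivAt_eq_slope _ _ zero_lt_one
    (fun r hr => (hder r hr).continuousAt.continuousWithinAt)
    (fun r hr => hder r (Ioo_subset_Icc_self hr))
  have hr' := Ioo_subset_Icc_self hr
  set x := w + (r : ℂ) * v
  have hwv : w + v = z := by rw [hv]; ring
  simp only [Complex.ofReal_one, one_mul, Complex.ofReal_zero, zero_mul, add_zero, sub_zero,
    div_one, hwv, ← map_sub] at hslope
  have hlow : δ * ‖v‖ ^ 2 ≤ ℓ (wirt (p x) (q x) v) := by
    have e : (starRingEnd ℂ) v * (p x * v + q x * (starRingEnd ℂ) v)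
        = ((‖v‖ ^ 2 : ℝ) : ℂ) * p x + q x * ((starRingEnd ℂ) v) ^ 2 := by
      rw [Complex.ofReal_pow, ← Complex.mul_conj']; ring
    rw [hℓa, wirt_apply, e, Complex.add_re, Complex.re_ofReal_mul]
    have h1 := Complex.abs_re_le_norm (q x * ((starRingEnd ℂ) v) ^ 2)
    rw [norm_mul, norm_pow, Complex.norm_conj] at h1
    have h2 := neg_le_of_abs_le h1
    have h3 := mul_le_mul_of_nonneg_right (hδ x (hmem r hr')) (by positivity : 0 ≤ ‖v‖ ^ 2)
    linarith
  have hup : ℓ (u z - u w) ≤ ‖v‖ * ‖u z - u w‖ := by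
    rw [hℓa]
    refine (Complex.re_le_norm _).trans ?_
    rw [norm_mul, Complex.norm_conj]
  rw [hslope] at hlow
  have h := hlow.trans hup
  have h' : ‖v‖ * (δ * ‖v‖) ≤ ‖v‖ * ‖u z - u w‖ := by linarith
  exact le_of_mul_le_mul_left h' hvpos

/-- A kernel vector satisfies `|p||v| = |q||v|`, hence vanishes; injectivity suffices in finite
dimension. -/
lemma surjective_wirt {p q : ℂ} (h : ‖q‖ < ‖p‖) : (wirt p q).range = ⊤ := by
  have hinj : Function.Injective (wirt p q : ℂ →ₗ[ℝ] ℂ) := by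
    rw [injective_iff_map_eq_zero]
    intro v hv
    have hv' : p * v + q * (starRingEnd ℂ) v = 0 := by rw [← wirt_apply]; exact hv
    have h1 : ‖p‖ * ‖v‖ = ‖q‖ * ‖v‖ := by
      have := congrArg norm (eq_neg_of_add_eq_zero_left hv')
      simpa using this
    by_contra hne
    exact h.ne' (mul_right_cancel₀ (norm_ne_zero_iff.2 hne) h1)
  exact LinearMap.range_eq_top.2 (LinearMap.injective_iff_surjective.1 hinj)

/-! ### Convexity from support lines -/

/-- An open set with a strict support functional at every frontier point is convex. -/
lemma convex_of_support {E : Type*} [NormedAddCommGroup E] [NormedSpace ℝ E] {Ω : Set E}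
    (hΩ : IsOpen Ω) (h : ∀ p ∈ frontier Ω, ∃ ℓ : E →L[ℝ] ℝ, ∀ w ∈ Ω, ℓ w < ℓ p) : Convex ℝ Ω := by
  rw [convex_iff_segment_subset]
  intro x hx y hy
  by_contra hns
  obtain ⟨z, hz, hzΩ⟩ := not_subset.1 hns
  -- By connectedness a segment that leaves `Ω` meets its frontier. There `ℓ p` would be a convex
  -- combination of `ℓ x` and `ℓ y`, both smaller than `ℓ p`.
  obtain ⟨p, hp, hpf⟩ : ∃ p ∈ segment ℝ x y, p ∈ frontier Ω := by
    by_contra! hno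
    rw [hΩ.frontier_eq] at hno
    have hout : ∀ p ∈ segment ℝ x y, p ∉ Ω → p ∈ (closure Ω)ᶜ := fun p hp hpΩ hpc =>
      hno p hp ⟨hpc, hpΩ⟩
    obtain ⟨p, -, hp1, hp2⟩ := (convex_segment x y).isPreconnected Ω (closure Ω)ᶜ hΩ
      isClosed_closure.isOpen_compl (fun p hp => or_iff_not_imp_left.2 (hout p hp))
      ⟨x, left_mem_segment ℝ x y, hx⟩ ⟨z, hz, hout z hz hzΩ⟩
    exact hp2 (subset_closure hp1)
  obtain ⟨ℓ, hℓ⟩ := h p hpf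
  obtain ⟨a, b, ha, hb, hab, rfl⟩ := hp
  have h1 := hℓ x hx
  have h2 := hℓ y hy
  rw [map_add, map_smul, map_smul, smul_eq_mul, smul_eq_mul] at h1 h2
  have e : b = 1 - a := by linarith
  subst e
  rcases ha.eq_or_lt with rfl | ha'
  · linarith
  · nlinarith [mul_pos ha' (sub_pos.2 h1), mul_nonneg hb (sub_pos.2 h2).le]

/-- A linear functional on the closure of a bounded open set takes its maximum on the frontier. -/
lemma lt_of_le_on_frontier {Ω : Set ℂ} (hΩ : IsOpen Ω) (hb : Bornology.IsBounded Ω) {n : ℂ}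
    (hn : n ≠ 0) {m : ℝ} (hm : ∀ p ∈ frontier Ω, ((starRingEnd ℂ) n * p).re ≤ m) {w : ℂ}
    (hw : w ∈ Ω) : ((starRingEnd ℂ) n * w).re < m := by
  have hcont : Continuous fun p : ℂ => ((starRingEnd ℂ) n * p).re := by fun_prop
  obtain ⟨x, hx, hmax⟩ := hb.isCompact_closure.exists_isMaxOn
    ⟨w, subset_closure hw⟩ hcont.continuousOn
  -- A small step in the direction `n` stays in `Ω` and increases the functional, so the maximum
  -- lies on the frontier and is not attained in `Ω`.
  have hout : ∀ y ∈ Ω, ∃ y' ∈ Ω, ((starRingEnd ℂ) n * y).re < ((starRingEnd ℂ) n * y').re := by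
    intro y hy
    have hlim : Tendsto (fun r : ℝ => y + (r : ℂ) * n) (𝓝[>] 0) (𝓝 y) := by
      have : ContinuousAt (fun r : ℝ => y + (r : ℂ) * n) 0 := by fun_prop
      have h := this.tendsto
      simp only [Complex.ofReal_zero, zero_mul, add_zero] at h
      exact h.mono_left nhdsWithin_le_nhds
    obtain ⟨r, hr, hr0⟩ := ((hlim.eventually (hΩ.mem_nhds hy)).and self_mem_nhdsWithin).exists
    refine ⟨_, hr, ?_⟩
    have e : (starRingEnd ℂ) n * (y + r * n)
        = (starRingEnd ℂ) n * y + ((r * ‖n‖ ^ 2 : ℝ) : ℂ) := by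
      push_cast
      rw [← Complex.mul_conj']; ring
    rw [e, Complex.add_re, Complex.ofReal_re]
    have hr0' : (0 : ℝ) < r := hr0
    have : 0 < r * ‖n‖ ^ 2 := by have := norm_pos_iff.2 hn; positivity
    linarith
  have hxf : x ∈ frontier Ω := by
    rw [hΩ.frontier_eq]
    refine ⟨hx, fun hxΩ => ?_⟩
    obtain ⟨y', hy', hlt⟩ := hout x hxΩ
    exact absurd (hmax (subset_closure hy')) (not_le.2 hlt)
  obtain ⟨w', hw', hlt⟩ := hout w hw
  exact hlt.trans_le ((hmax (subset_closure hw')).trans (hm x hxf))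

lemma norm_pow_sub_one_le {w : ℂ} (hw : ‖w‖ = 1) (k : ℕ) : ‖w ^ k - 1‖ ≤ k * ‖w - 1‖ := by
  induction k with
  | zero => simp
  | succ k ih =>
    have e : w ^ (k + 1) - 1 = w * (w ^ k - 1) + (w - 1) := by ring
    rw [e]
    refine (norm_add_le _ _).trans ?_
    rw [norm_mul, hw]
    push_cast
    linarith

/-- Second-order Taylor remainder of `w^k` at 1: it grows by `(w^k - 1)(w - 1)` at each step, at
most `k|w-1|²`, and these add up to `k(k-1)/2`. -/
lemma norm_pow_sub_linear_le {w : ℂ} (hw : ‖w‖ = 1) (k : ℕ) :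
    ‖w ^ k - k * w + (k - 1)‖ ≤ k * (k - 1) / 2 * ‖w - 1‖ ^ 2 := by
  induction k with
  | zero => simp
  | succ k ih =>
    have e : w ^ (k + 1) - (k + 1 : ℕ) * w + ((k + 1 : ℕ) - 1)
        = (w ^ k - k * w + (k - 1)) + (w ^ k - 1) * (w - 1) := by push_cast; ring
    rw [e]
    refine (norm_add_le _ _).trans ?_
    rw [norm_mul]
    have h := mul_le_mul_of_nonneg_right (norm_pow_sub_one_le hw k) (norm_nonneg (w - 1))
    push_cast
    linarith

/-- The curve `A ζ + B ζ̄^k` lies on one side of each of its tangent lines when `k² |B| ≤ A`. -/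
lemma support_line {A B : ℝ} {k : ℕ} (hk : 1 ≤ k) (hA : 0 < A) (hB : |B| * k ^ 2 ≤ A)
    {ζ ξ : ℂ} (hζ : ‖ζ‖ = 1) (hξ : ‖ξ‖ = 1) :
    ((starRingEnd ℂ) (A * ζ - k * B * (starRingEnd ℂ) ζ ^ k)
        * (A * ξ + B * (starRingEnd ℂ) ξ ^ k)).re
      ≤ ((starRingEnd ℂ) (A * ζ - k * B * (starRingEnd ℂ) ζ ^ k)
        * (A * ζ + B * (starRingEnd ℂ) ζ ^ k)).re := by
  -- The tangent at `ζ` is `i(Aζ - kBζ̄^k)`, so the functional is the one given by the normal. With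
  -- `ξ = wζ`, every term is measured against `D = |w-1|²`.
  set ζ' := (starRingEnd ℂ) ζ with hζ'
  have hζζ : ζ * ζ' = 1 := by rw [hζ', Complex.mul_conj', hζ]; simp
  set w := ξ * ζ' with hwdef
  have hw : ‖w‖ = 1 := by rw [hwdef, norm_mul, hζ', Complex.norm_conj, hζ, hξ, one_mul]
  have hξw : ξ = w * ζ := by rw [hwdef]; linear_combination (-ξ) * hζζ
  set w' := (starRingEnd ℂ) w with hw'
  have hξ' : (starRingEnd ℂ) ξ = w' * ζ' := by rw [hξw, map_mul]
  have hww : w * w' = 1 := by rw [hw', Complex.mul_conj', hw]; simp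
  have hw1 : ‖w'‖ = 1 := by rw [hw', Complex.norm_conj, hw]
  have hconj : (starRingEnd ℂ) (A * ζ - k * B * ζ' ^ k) = A * ζ' - k * B * ζ ^ k := by
    simp [hζ']
  have hζk : ζ ^ k * ζ' ^ k = 1 := by rw [← mul_pow, hζζ, one_pow]
  rw [hconj, hξ', hξw, mul_pow]
  set D := ‖w - 1‖ ^ 2 with hD
  have hD0 : 0 ≤ D := by positivity
  have hD' : ‖w' - 1‖ ^ 2 = D := by
    rw [hD, hw', ← Complex.norm_conj (w - 1), map_sub, map_one]
  have hre : ∀ x : ℂ, ‖x‖ = 1 → (x - 1).re = -(‖x - 1‖ ^ 2 / 2) := by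
    intro x hx
    have h1 : x.re ^ 2 + x.im ^ 2 = 1 := by
      have := Complex.sq_norm x
      rw [hx, Complex.normSq_apply] at this; linarith
    rw [Complex.sq_norm, Complex.normSq_apply]
    simp only [Complex.sub_re, Complex.sub_im, Complex.one_re, Complex.one_im]
    linarith
  set η := ζ' ^ (k + 1) with hη
  have hηn : ‖η‖ = 1 := by rw [hη, norm_pow, hζ', Complex.norm_conj, hζ, one_pow]
  have key : (A * ζ' - k * B * ζ ^ k) * (A * (w * ζ) + B * (w' ^ k * ζ' ^ k))
      - (A * ζ' - k * B * ζ ^ k) * (A * ζ + B * ζ' ^ k)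
      = ((A ^ 2 : ℝ) : ℂ) * (w - 1) + ((-(k * B ^ 2) : ℝ) : ℂ) * (w' ^ k - 1)
        + ((A * B : ℝ) : ℂ) * (η * (w' ^ k - 1) - k * ((starRingEnd ℂ) η * (w - 1))) := by
    have hηc : (starRingEnd ℂ) η = ζ ^ (k + 1) := by rw [hη, map_pow, hζ', Complex.conj_conj]
    rw [hηc, hη]
    push_cast
    linear_combination (A ^ 2 * (w - 1)) * hζζ - (k * B ^ 2 * (w' ^ k - 1)) * hζk
  -- Conjugating the second cross term cancels the first-order part and leaves the Taylor remainder
  -- of `w'^k`.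
  have h3 : (η * (w' ^ k - 1) - k * ((starRingEnd ℂ) η * (w - 1))).re
      = (η * (w' ^ k - k * w' + (k - 1))).re := by
    have e : (k * ((starRingEnd ℂ) η * (w - 1))).re = (k * (η * (w' - 1))).re := by
      rw [← Complex.conj_re]
      congr 1
      simp [hw']
    rw [Complex.sub_re, e, ← Complex.sub_re]
    congr 1; ring
  have h4 : |(η * (w' ^ k - k * w' + (k - 1))).re| ≤ k * (k - 1) / 2 * D := by
    refine (Complex.abs_re_le_norm _).trans ?_
    rw [norm_mul, hηn, one_mul, ← hD']
    exact norm_pow_sub_linear_le hw1 k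
  have h5 : -(k ^ 2 * D / 2) ≤ (w' ^ k - 1).re := by
    rw [hre _ (by rw [norm_pow, hw1, one_pow])]
    have h := norm_pow_sub_one_le hw1 k
    have h2 := pow_le_pow_left₀ (norm_nonneg _) h 2
    rw [mul_pow, hD'] at h2
    linarith
  have hk' : (1 : ℝ) ≤ k := by exact_mod_cast hk
  have h6 : A * B * (η * (w' ^ k - 1) - k * ((starRingEnd ℂ) η * (w - 1))).re
      ≤ A * |B| * (k * (k - 1) / 2 * D) := by
    rw [h3]
    refine (le_abs_self _).trans ?_
    rw [abs_mul, abs_mul, abs_of_pos hA]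
    exact mul_le_mul_of_nonneg_left h4 (by positivity)
  have h7 : -(k * B ^ 2) * (w' ^ k - 1).re ≤ k * B ^ 2 * (k ^ 2 * D / 2) := by
    have := mul_le_mul_of_nonneg_left h5 (by positivity : 0 ≤ k * B ^ 2)
    linarith
  have h8 : A ^ 2 * (w - 1).re = -(A ^ 2 * (D / 2)) := by rw [hre w hw]; ring
  -- From `|B|k² ≤ A` the first summand is at most `kA|B|`, and the total at most `A|B|k² ≤ A²`.
  have hfin : k * B ^ 2 * k ^ 2 + A * |B| * (k * (k - 1)) ≤ A ^ 2 := by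
    have hB2 : B ^ 2 = |B| ^ 2 := (sq_abs B).symm
    rw [hB2]
    have hb0 := abs_nonneg B
    have e1 : k * |B| ^ 2 * (k : ℝ) ^ 2 ≤ k * |B| * A := by
      calc k * |B| ^ 2 * (k : ℝ) ^ 2 = k * |B| * (|B| * k ^ 2) := by ring
        _ ≤ k * |B| * A := mul_le_mul_of_nonneg_left hB (by positivity)
    calc _ ≤ k * |B| * A + A * |B| * (k * (k - 1)) := by linarith
      _ = A * (|B| * k ^ 2) := by ring
      _ ≤ A * A := mul_le_mul_of_nonneg_left hB hA.le
      _ = A ^ 2 := by ring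
  have hkey := congrArg Complex.re key
  simp only [Complex.sub_re, Complex.add_re, Complex.re_ofReal_mul] at hkey h6 h7 h8
  have h9 := mul_le_mul_of_nonneg_right hfin (by positivity : 0 ≤ D / 2)
  linarith

/-! ### Passage to the closed disk -/

/-- An expansion estimate on the disk extends to the closed disk. -/
lemma expanding_closedBall {U : ℂ → ℂ} (hU : ContinuousOn U (Metric.closedBall 0 1)) {δ : ℝ}
    (h : ∀ z ∈ Metric.ball (0 : ℂ) 1, ∀ w ∈ Metric.ball (0 : ℂ) 1, δ * ‖z - w‖ ≤ ‖U z - U w‖)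
    {z w : ℂ} (hz : z ∈ Metric.closedBall (0 : ℂ) 1) (hw : w ∈ Metric.closedBall (0 : ℂ) 1) :
    δ * ‖z - w‖ ≤ ‖U z - U w‖ := by
  have hmem : ∀ z ∈ Metric.closedBall (0 : ℂ) 1, ∀ r ∈ Ioo (0 : ℝ) 1,
      (r : ℂ) * z ∈ Metric.ball (0 : ℂ) 1 := by
    intro z hz r hr
    rw [mem_closedBall_zero_iff] at hz
    rw [mem_ball_zero_iff, norm_mul, Complex.norm_real, Real.norm_of_nonneg hr.1.le]
    nlinarith [hr.1, hr.2, norm_nonneg z]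
  have hmul : ∀ z : ℂ, Tendsto (fun r : ℝ => (r : ℂ) * z) (𝓝[<] 1) (𝓝 z) := by
    intro z
    have : ContinuousAt (fun r : ℝ => (r : ℂ) * z) 1 := by fun_prop
    have h := this.tendsto
    simp only [Complex.ofReal_one, one_mul] at h
    exact h.mono_left nhdsWithin_le_nhds
  have hIoo : ∀ᶠ r : ℝ in 𝓝[<] 1, r ∈ Ioo (0 : ℝ) 1 := Ioo_mem_nhdsLT zero_lt_one
  have hlim : ∀ z ∈ Metric.closedBall (0 : ℂ) 1,
      Tendsto (fun r : ℝ => U ((r : ℂ) * z)) (𝓝[<] 1) (𝓝 (U z)) := by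
    intro z hz
    refine (hU z hz).tendsto.comp (tendsto_nhdsWithin_iff.2 ⟨hmul z, ?_⟩)
    filter_upwards [hIoo] with r hr
    exact Metric.ball_subset_closedBall (hmem z hz r hr)
  refine le_of_tendsto_of_tendsto (((hmul z).sub (hmul w)).norm.const_mul δ)
    ((hlim z hz).sub (hlim w hw)).norm ?_
  filter_upwards [hIoo] with r hr
  exact h _ (hmem z hz r hr) _ (hmem w hw r hr)

/-- The closure of the image is the compact image of the closed disk; injectivity separates the
images of disk and circle. -/
lemma frontier_image_ball {U : ℂ → ℂ} (hU : ContinuousOn U (Metric.closedBall 0 1))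
    (hinj : InjOn U (Metric.closedBall 0 1)) (hopen : IsOpen (U '' Metric.ball 0 1)) :
    frontier (U '' Metric.ball 0 1) = U '' Metric.sphere 0 1 := by
  have hcl : closure (Metric.ball (0 : ℂ) 1) = Metric.closedBall 0 1 :=
    closure_ball 0 one_ne_zero
  have hclU : closure (U '' Metric.ball 0 1) = U '' Metric.closedBall 0 1 := by
    refine Subset.antisymm ?_ ?_
    · exact closure_minimal (image_mono Metric.ball_subset_closedBall)
        ((isCompact_closedBall 0 1).image_of_continuousOn hU).isClosed
    · rw [← hcl]
      exact ContinuousOn.image_closure (hcl ▸ hU)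
  rw [hopen.frontier_eq, hclU, ← hinj.image_sdiff_subset Metric.ball_subset_closedBall,
    Metric.closedBall_sdiff_ball]

/-- The continuous extension of `F_j` to `[0, 1]`. -/
def radExt (a : ℝ) (j : ℕ) (t : ℝ) : ℝ :=
  if t < 1 then psum (radCoeff a j) t else radOne a j

lemma continuousOn_radExt {a : ℝ} (ha : 0 < a) (j : ℕ) : ContinuousOn (radExt a j) (Icc 0 1) := by
  intro t ht
  rcases ht.2.lt_or_eq with h1 | rfl
  · have hc : ContinuousAt (psum (radCoeff a j)) t :=
      ((diskSummable_hyp _ _ _).hasDerivAt (abs_lt_one_of_mem ⟨ht.1, h1⟩)).continuousAt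
    refine (hc.congr ?_).continuousWithinAt
    filter_upwards [gt_mem_nhds h1] with s hs
    rw [radExt, if_pos hs]
  · rw [← Ico_insert_right zero_le_one, continuousWithinAt_insert_self, ContinuousWithinAt]
    have hv : radExt a j 1 = radOne a j := by rw [radExt, if_neg (lt_irrefl 1)]
    rw [hv]
    have h := (tendsto_psum_radCoeff ha j).mono_left
      (nhdsWithin_mono 1 (Ico_subset_Iio_self (a := (0 : ℝ))))
    refine h.congr' ?_
    filter_upwards [self_mem_nhdsWithin] with s hs
    rw [radExt, if_pos hs.2]

/-- The continuous extension of `closedForm` to the closed disk. -/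
def extForm (a : ℝ) (k : ℕ) (c : ℝ) (z : ℂ) : ℂ :=
  (radExt a 1 (‖z‖ ^ 2) : ℂ) * z + c * (radExt a k (‖z‖ ^ 2) : ℂ) * (starRingEnd ℂ) z ^ k

lemma extForm_eq_closedForm {a : ℝ} {k : ℕ} {c : ℝ} {z : ℂ} (hz : ‖z‖ < 1) :
    extForm a k c z = closedForm a k c z := by
  rw [extForm, closedForm, radExt, radExt, if_pos (norm_sq_mem hz).2, if_pos (norm_sq_mem hz).2]

lemma extForm_of_norm_eq_one {a : ℝ} {k : ℕ} {c : ℝ} {z : ℂ} (hz : ‖z‖ = 1) :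
    extForm a k c z
      = (radOne a 1 : ℂ) * z + ((c * radOne a k : ℝ) : ℂ) * (starRingEnd ℂ) z ^ k := by
  simp [extForm, radExt, hz]

lemma boundaryMap_eq_extForm {α : ℝ} (hα : 0 < α) (k : ℕ) (c : ℝ) (ζ : Circle) :
    boundaryMap α k c ζ = extForm (α / 2) k c ζ := by
  rw [extForm_of_norm_eq_one ζ.norm_coe, boundaryMap, hypFOne_eq hα, hypFOne_eq hα, zpow_neg,
    zpow_natCast, ← inv_pow, ← Circle.coe_inv, Circle.coe_inv_eq_conj]
  push_cast
  rfl

lemma continuousOn_extForm {a : ℝ} (ha : 0 < a) (k : ℕ) (c : ℝ) :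
    ContinuousOn (extForm a k c) (Metric.closedBall 0 1) := by
  have h : ∀ j, ContinuousOn (fun z : ℂ => (radExt a j (‖z‖ ^ 2) : ℂ))
      (Metric.closedBall 0 1) := by
    intro j
    refine Complex.continuous_ofReal.comp_continuousOn
      ((continuousOn_radExt ha j).comp (by fun_prop) fun z hz => ?_)
    rw [mem_closedBall_zero_iff] at hz
    exact ⟨by positivity, pow_le_one₀ (norm_nonneg z) hz⟩
  unfold extForm
  exact ((h 1).mul continuousOn_id).add ((continuousOn_const.mul (h k)).mul (by fun_prop))

/-! ### The meaning of the bounds `M` and `N` -/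

/-- Here `N = (α/2)/(X + k)` with `X ≥ 0`, because `α/2 ≤ 1 ≤ k`; hence `N ≤ α/(2k)`. -/
lemma abs_mul_lt_of_lt_boundN {α : ℝ} (hα : α ∈ Ioc (0 : ℝ) 2) {k : ℕ} (hk : 1 ≤ k) {c : ℝ}
    (hc : |c| < boundN α k) : |c| * k < α / 2 := by
  have hk' : (1 : ℝ) ≤ k := by exact_mod_cast hk
  have hα0 := hα.1
  have h1 := Real.Gamma_pos_of_pos (show (0 : ℝ) < k + 1 by positivity)
  have h2 := Real.Gamma_pos_of_pos (show (0 : ℝ) < 2 + α / 2 by positivity)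
  have h3 := Real.Gamma_pos_of_pos (show (0 : ℝ) < k + 1 + α / 2 by positivity)
  have h4 : 0 ≤ (k : ℝ) - α / 2 := by linarith [hα.2]
  rw [boundN] at hc
  set X := ((k : ℝ) - α / 2) * Real.Gamma (k + 1) * Real.Gamma (2 + α / 2)
    / Real.Gamma (k + 1 + α / 2) with hX
  have hX0 : 0 ≤ X := by positivity
  have hpos : 0 < 2 * (X + k) := by positivity
  rw [lt_div_iff₀ hpos] at hc
  nlinarith [mul_nonneg (abs_nonneg c) hX0]

/-- By Gauss's formula, `M = F_1(1) / (k² F_k(1))`. -/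
lemma abs_mul_radOne_lt_of_lt_boundM {α : ℝ} (hα : 0 < α) {k : ℕ} (hk : 1 ≤ k) {c : ℝ}
    (hc : |c| < boundM α k) :
    |c * radOne (α / 2) k| * k ^ 2 < radOne (α / 2) 1 := by
  have hk' : (1 : ℝ) ≤ k := by exact_mod_cast hk
  have h1 := Real.Gamma_pos_of_pos (show (0 : ℝ) < k + 1 by positivity)
  have h2 := Real.Gamma_pos_of_pos (show (0 : ℝ) < 2 + α / 2 by positivity)
  have h3 := Real.Gamma_pos_of_pos (show (0 : ℝ) < k + 1 + α / 2 by positivity)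
  have h4 := Real.Gamma_pos_of_pos (show (0 : ℝ) < 1 + 2 * (α / 2) by positivity)
  have h5 := Real.Gamma_pos_of_pos (show (0 : ℝ) < α / 2 + 1 by positivity)
  have hr := radOne_pos (half_pos hα) k
  have he : radOne (α / 2) 1 = boundM α k * radOne (α / 2) k * k ^ 2 := by
    have e1 : α / 2 + 1 + k = k + 1 + α / 2 := by ring
    have e2 : α / 2 + 1 + (1 : ℕ) = 2 + α / 2 := by push_cast; ring
    have e3 : Real.Gamma ((1 : ℕ) + 1) = 1 := by
      rw [Nat.cast_one, one_add_one_eq_two, Real.Gamma_two]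
    rw [radOne, radOne, boundM, e1, e2, e3]
    field_simp
  rw [he, abs_mul, abs_of_pos hr]
  gcongr

end RealKernel

end

/-! ### The main theorem -/

open RealKernel in
theorem proposition4p6 (α : ℝ) (hα : α ∈ Set.Ioc (0 : ℝ) 2) (k : ℕ) (hk : 1 ≤ k) (c : ℝ)
    (hc : c ∈ Set.Ioo (-(min (RealKernel.boundM α k) (RealKernel.boundN α k)))
      (min (RealKernel.boundM α k) (RealKernel.boundN α k))) :
    ∃ γ Ω : Set ℂ,
      -- `f` is a homeomorphism of the unit circle onto `γ`
      Topology.IsEmbedding (RealKernel.boundaryMap α k c) ∧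
      Set.range (RealKernel.boundaryMap α k c) = γ ∧
      -- `γ` is the boundary of the bounded convex domain `Ω`
      IsOpen Ω ∧ Ω.Nonempty ∧ Convex ℝ Ω ∧ Bornology.IsBounded Ω ∧ frontier Ω = γ ∧
      -- the Poisson type extension is a univalent real kernel harmonic mapping of the disk onto `Ω`
      RealKernel.IsRealKernelHarmonic α
        (RealKernel.poissonExt α (RealKernel.boundaryMap α k c)) ∧
      Set.InjOn (RealKernel.poissonExt α (RealKernel.boundaryMap α k c)) (Metric.ball 0 1) ∧
      RealKernel.poissonExt α (RealKernel.boundaryMap α k c) '' Metric.ball 0 1 = Ω := by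
  have hα0 : 0 < α := hα.1
  set a := α / 2 with ha
  have ha0 : 0 < a := half_pos hα0
  have ha1 : a ≤ 1 := by rw [ha]; linarith [hα.2]
  have hcabs := abs_lt.2 hc
  have hcN : |c| * k < a := abs_mul_lt_of_lt_boundN hα hk (hcabs.trans_le (min_le_right _ _))
  have hcM := abs_mul_radOne_lt_of_lt_boundM hα0 hk (hcabs.trans_le (min_le_left _ _))
  rw [← ha] at hcM
  set δ := (a - |c| * k) * radOne a 1 with hδ
  have hδ0 : 0 < δ := mul_pos (by linarith) (radOne_pos ha0 1)
  set U := extForm a k c with hU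
  set u := closedForm a k c with hu
  have hUu : EqOn U u (Metric.ball 0 1) := fun z hz =>
    extForm_eq_closedForm (mem_ball_zero_iff.1 hz)
  have hPu : EqOn (poissonExt α (boundaryMap α k c)) u (Metric.ball 0 1) := fun z hz =>
    poissonExt_boundaryMap hα0 k c (mem_ball_zero_iff.1 hz)
  have hUc : ContinuousOn U (Metric.closedBall 0 1) := continuousOn_extForm ha0 k c
  have hder : ∀ z ∈ Metric.ball (0 : ℂ) 1,
      HasFDerivAt u (wirt (closedFormZ a k c z) (closedFormZbar a k c z)) z := fun z hz =>
    hasWirt_closedForm a k c (mem_ball_zero_iff.1 hz)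
  have hlow : ∀ z ∈ Metric.ball (0 : ℂ) 1,
      δ ≤ (closedFormZ a k c z).re - ‖closedFormZbar a k c z‖ := fun z hz =>
    re_closedFormZ_sub_norm ha0 ha1 hk hcN.le (mem_ball_zero_iff.1 hz)
  have hexp : ∀ z ∈ Metric.closedBall (0 : ℂ) 1, ∀ w ∈ Metric.closedBall (0 : ℂ) 1,
      δ * ‖z - w‖ ≤ ‖U z - U w‖ := fun z hz w hw =>
    expanding_closedBall hUc (fun z hz w hw => by
      rw [hUu hz, hUu hw]
      exact expanding_of_wirt (convex_ball 0 1) hder hlow hz hw) hz hw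
  have hinj : InjOn U (Metric.closedBall 0 1) := by
    intro z hz w hw hzw
    have h := hexp z hz w hw
    rw [hzw, sub_self, norm_zero] at h
    have h' : ‖z - w‖ ≤ 0 := by
      by_contra! hpos
      exact absurd h (not_le.2 (mul_pos hδ0 hpos))
    exact sub_eq_zero.1 (norm_le_zero_iff.1 h')
  have himage : U '' Metric.ball 0 1 = u '' Metric.ball 0 1 := hUu.image_eq
  have hopen : IsOpen (U '' Metric.ball 0 1) := by
    rw [himage, isOpen_iff_mem_nhds]
    rintro _ ⟨z, hz, rfl⟩
    -- Openness of the image follows from the surjectivity of the strict differential, which holds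
    -- since `|u_z̄| < |u_z|`.
    have hstrict : HasStrictFDerivAt u (wirt (closedFormZ a k c z) (closedFormZbar a k c z)) z := by
      have h1 := ((contDiffOn_closedForm a k c).contDiffAt
        (Metric.isOpen_ball.mem_nhds hz)).hasStrictFDerivAt two_ne_zero
      rwa [(hder z hz).fderiv] at h1
    have hlt : ‖closedFormZbar a k c z‖ < ‖closedFormZ a k c z‖ := by
      linarith [hlow z hz, Complex.re_le_norm (closedFormZ a k c z)]
    rw [← hstrict.map_nhds_eq_of_surj (surjective_wirt hlt)]
    exact image_mem_map (Metric.isOpen_ball.mem_nhds hz)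
  have hbdd : Bornology.IsBounded (U '' Metric.ball 0 1) :=
    ((isCompact_closedBall 0 1).image_of_continuousOn hUc).isBounded.subset
      (image_mono Metric.ball_subset_closedBall)
  have hfront := frontier_image_ball hUc hinj hopen
  have hbU : ∀ ζ : Circle, boundaryMap α k c ζ = U ζ := boundaryMap_eq_extForm hα0 k c
  have hsph : ∀ ζ : Circle, (ζ : ℂ) ∈ Metric.sphere (0 : ℂ) 1 := fun ζ =>
    mem_sphere_zero_iff_norm.2 ζ.norm_coe
  have hrange : range (boundaryMap α k c) = U '' Metric.sphere 0 1 := by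
    ext p
    constructor
    · rintro ⟨ζ, rfl⟩
      exact ⟨ζ, hsph ζ, (hbU ζ).symm⟩
    · rintro ⟨z, hz, rfl⟩
      exact ⟨⟨z, hz⟩, hbU _⟩
  refine ⟨_, U '' Metric.ball 0 1, ?_, rfl, hopen, ⟨_, mem_image_of_mem U
    (Metric.mem_ball_self one_pos)⟩, ?_, hbdd, hfront.trans hrange.symm,
    isRealKernelHarmonic_of_eqOn hk hPu, ?_, ?_⟩
  · refine Topology.IsClosedEmbedding.isEmbedding (Continuous.isClosedEmbedding ?_ ?_)
    · have h : Continuous fun ζ : Circle => U ζ :=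
        hUc.comp_continuous continuous_subtype_val
          fun ζ => Metric.sphere_subset_closedBall (hsph ζ)
      exact h.congr fun ζ => (hbU ζ).symm
    · intro ζ ξ h
      rw [hbU, hbU] at h
      exact Subtype.ext (hinj (Metric.sphere_subset_closedBall (hsph ζ))
        (Metric.sphere_subset_closedBall (hsph ξ)) h)
  · refine convex_of_support hopen fun p hp => ?_
    rw [hfront] at hp
    obtain ⟨ζ, hζ, rfl⟩ := hp
    rw [mem_sphere_zero_iff_norm] at hζ
    set A := radOne a 1 with hA
    set B := c * radOne a k with hB
    have hA0 : 0 < A := radOne_pos ha0 1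
    set n : ℂ := A * ζ - k * B * (starRingEnd ℂ) ζ ^ k with hn
    have hk' : (1 : ℝ) ≤ k := by exact_mod_cast hk
    -- A vanishing normal would force `A = k|B| ≤ k²|B| < A`.
    have hn0 : n ≠ 0 := by
      intro h0
      have h1 := congrArg norm (sub_eq_zero.1 h0)
      simp only [norm_mul, norm_pow, Complex.norm_conj, hζ, one_pow, mul_one, Complex.norm_real,
        Complex.norm_natCast, Real.norm_eq_abs, abs_of_pos hA0] at h1
      have h2 : (k : ℝ) * |B| ≤ |B| * k ^ 2 := by
        nlinarith [abs_nonneg B, mul_nonneg (abs_nonneg B) (sub_nonneg.2 hk')]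
      linarith
    refine ⟨Complex.reCLM.comp (wirt ((starRingEnd ℂ) n) 0), fun w hw => ?_⟩
    simp only [ContinuousLinearMap.comp_apply, Complex.reCLM_apply, wirt_apply, zero_mul,
      add_zero]
    refine lt_of_le_on_frontier hopen hbdd hn0 (fun q hq => ?_) hw
    rw [hfront] at hq
    obtain ⟨ξ, hξ, rfl⟩ := hq
    rw [mem_sphere_zero_iff_norm] at hξ
    rw [hU, extForm_of_norm_eq_one hξ, extForm_of_norm_eq_one hζ]
    exact support_line hk hA0 hcM.le hζ hξ
  · exact ((hinj.mono Metric.ball_subset_closedBall).congr hUu).congr hPu.symm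
  · rw [himage]; exact hPu.image_eq
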